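/- Let $L$ be a Lie algebra over a field. Write $\mathrm{Inn}(L)$ for the Lie algebra of inner derivations $\mathrm{ad}(a)\colon b\mapsto[a,b]$, and $\mathrm{AID}(L)$ for the Lie algebra of almost-inner derivations, that is, derivations $\delta$ of $L$ with $\delta(a)\in[L,a]$ for all $a\in L$. Put $Ш(L)=\mathrm{AID}(L)/\mathrm{Inn}(L)$. For a prime $p$, let $F=\mathbb F_{p^3}$, and for $e\in\{1,2\}$ let $R=F\oplus F\pi\oplus F\pi^2$ be the ring with $\pi f=f^{p^e}\pi$ for $f\in F$ and $\pi^3=0$. The multiplicative group $U_1(R)=1+R\pi$ acts on the additive group $(R,+)$ by left multiplication; let $G_p^{(e)}=(R,+)\rtimes U_1(R)$, a group of order $p^{15}$. For a group $G$ let $G^1=G$, $G^{i+1}=[G^i,G](G^i)^p$ be its $p$-central series, and let $\mathcal L_p(G)=\bigoplus_{i\ge1}G^i/G^{i+1}$ be the Lie algebra over $\mathbb F_p$ whose bracket is induced by the commutator of $G$. Let $\mathfrak g_3$ be the Lie algebra over $\mathbb F_3$ with basis $v_1,\dots,v_{15}$ and the products $$\begin{aligned} &[v_1,v_2]=2v_7,\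 [v_1,v_3]=v_7+2v_8,\ [v_1,v_4]=2v_{10},\ [v_1,v_5]=v_{11},\ [v_1,v_6]=v_{12},\\ &[v_1,v_{10}]=2v_{13},\ [v_1,v_{11}]=v_{14}+v_{15},\ [v_1,v_{12}]=2v_{15},\\ &[v_2,v_3]=2v_8+v_9,\ [v_2,v_4]=2v_{12},\ [v_2,v_5]=2v_{10}+v_{12},\ [v_2,v_6]=v_{11},\\ &[v_2,v_{10}]=v_{13}+2v_{15},\ [v_2,v_{11}]=v_{13}+2v_{14}+v_{15},\ [v_2,v_{12}]=v_{14}+2v_{15},\\ &[v_3,v_4]=2v_{11},\ [v_3,v_5]=v_{11}+2v_{12},\ [v_3,v_6]=2v_{10}+v_{12},\\ &[v_3,v_{10}]=2v_{13}+v_{14},\ [v_3,v_{11}]=v_{13}+2v_{14}+2v_{15},\ [v_3,v_{12}]=v_{13}+v_{14}+2v_{15},\\ &[v_4,v_7]=v_{13},\ [v_4,v_8]=2v_{15},\ [v_4,v_9]=v_{14}+v_{15},\\ &[v_5,v_7]=v_{14}+v_{15},\ [v_5,v_8]=2v_{13}+v_{15},\ [v_5,v_9]=2v_{14}+v_{15},\\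 &[v_6,v_7]=2v_{15},\ [v_6,v_8]=2v_{14}+2v_{15},\ [v_6,v_9]=2v_{13}+v_{15}, \end{aligned}$$ where $[v_j,v_i]=-[v_i,v_j]$ and all other products of basis vectors are $0$. Let $d_1,d_2$ be the linear maps of $\mathfrak g_3$ with $$\begin{aligned} &d_1(v_2)=v_7,\ d_1(v_3)=2v_7+v_8,\ d_1(v_4)=2v_{11}+2v_{12},\ d_1(v_5)=2v_{10},\ d_1(v_6)=v_{10},\\ &d_1(v_{10})=v_{14},\ d_1(v_{11})=v_{13},\ d_1(v_{12})=2v_{13},\\ &d_2(v_2)=v_{10},\ d_2(v_7)=v_{13},\ d_2(v_8)=v_{13},\ d_2(v_9)=2v_{13}+2v_{14}, \end{aligned}$$ and value $0$ on all other basis vectors. Then the following hold. 1. $\mathfrak g_3\cong\mathcal L_3(G_3^{(2)})$. Moreover $\dim\mathfrak g_3=15$, $\dim\mathrm{Der}(\mathfrak g_3)=45$ and $\dim\mathrm{Inn}(\mathfrak g_3)=12$. There is a Lie subalgebra $U\le\mathrm{Der}(\mathfrak g_3)$ of dimension $21$ with $\mathrm{AID}(\mathfrak g_3)=\mathrm{Inn}(\mathfrak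 g_3)\oplus U$ (as vector spaces) and $d_1,d_2\in U$; in particular $d_1,d_2$ are almost-inner derivations. Furthermore $[d_1,d_2]\notin\mathrm{Inn}(\mathfrak g_3)$. Hence the Lie algebra $Ш(\mathfrak g_3)$ is non-abelian. 2. For $e\in\{1,2\}$ let $\mathfrak g_2=\mathcal L_2(G_2^{(e)})$, a Lie algebra over $\mathbb F_2$. Then $\dim\mathfrak g_2=15$, $\mathrm{AID}(\mathfrak g_2)=\mathrm{Inn}(\mathfrak g_2)\oplus U$ for a subspace $U$ of dimension $21$, and $Ш(\mathfrak g_2)$ is non-abelian. -/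

import Mathlib

/-! ### Almost-inner derivations and the Tate-Shafarevich algebra -/

section AlmostInner

variable (R L : Type*) [CommRing R] [LieRing L] [LieAlgebra R L]

/-- `Inn(L)`: the Lie algebra of inner derivations `ad(a) : b ↦ ⁅a, b⁆`. -/
def InnDer : LieSubalgebra R (LieDerivation R L L) := (LieDerivation.ad R L).range

/-- `AID(L)`: the derivations `δ` with `δ(a) ∈ ⁅L, a⁆` for every `a`. -/
def AID : LieSubalgebra R (LieDerivation R L L) where
  carrier := {δ | ∀ a : L, ∃ x : L, δ a = ⁅x, a⁆}
  zero_mem' := fun a => ⟨0, by simp⟩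
  add_mem' := by
    intro δ ε hδ hε a
    obtain ⟨x, hx⟩ := hδ a
    obtain ⟨y, hy⟩ := hε a
    exact ⟨x + y, by simp [hx, hy]⟩
  smul_mem' := by
    intro r δ hδ a
    obtain ⟨x, hx⟩ := hδ a
    exact ⟨r • x, by simp [hx]⟩
  lie_mem' := by
    intro δ ε hδ hε a
    obtain ⟨x, hx⟩ := hδ a
    obtain ⟨y, hy⟩ := hε a
    refine ⟨δ y - ε x - ⁅x, y⁆, ?_⟩
    rw [LieDerivation.lie_apply, hx, hy, LieDerivation.apply_lie_eq_add,
      LieDerivation.apply_lie_eq_add, hx, hy, sub_lie, sub_lie, lie_lie]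
    abel

/-- The ideal of inner derivations in `AID(L)`. -/
def innIdeal : LieIdeal R (AID R L) where
  carrier := {δ | (δ : LieDerivation R L L) ∈ InnDer R L}
  zero_mem' := (InnDer R L).zero_mem
  add_mem' := fun ha hb => (InnDer R L).add_mem ha hb
  smul_mem' := fun r _ ha => (InnDer R L).smul_mem r ha
  lie_mem := by
    rintro δ _ ⟨a, ha⟩
    refine ⟨(δ : LieDerivation R L L) a, ?_⟩
    rw [LieSubalgebra.coe_bracket, ← ha]
    exact (LieDerivation.lie_der_ad_eq_ad_der _ a).symm

/-- `Ш(L) = AID(L) / Inn(L)`. -/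
abbrev Sha : Type _ := AID R L ⧸ innIdeal R L

end AlmostInner

/-! ### The Lie algebra of the `p`-central series of a group -/

section PCentral

open scoped commutatorElement

variable (p : ℕ) (G : Type*) [Group G]

/-- The `p`-central series `G = G¹ ≥ G² ≥ …` with `Gⁱ⁺¹ = [Gⁱ, G] (Gⁱ)ᵖ`;
`pCentralSeries p G n` is the term `Gⁿ⁺¹`. -/
def pCentralSeries : ℕ → Subgroup G
  | 0 => ⊤
  | n + 1 => ⁅pCentralSeries n, (⊤ : Subgroup G)⁆ ⊔
      Subgroup.closure ((fun x => x ^ p) '' (pCentralSeries n : Set G))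

variable {p G}

theorem pow_mem_pCentralSeries {n : ℕ} {x : G} (hx : x ∈ pCentralSeries p G n) :
    x ^ p ∈ pCentralSeries p G (n + 1) :=
  Subgroup.mem_sup_right (Subgroup.subset_closure ⟨x, hx, rfl⟩)

theorem comm_mem_pCentralSeries_succ {n : ℕ} {x : G} (hx : x ∈ pCentralSeries p G n) (y : G) :
    ⁅x, y⁆ ∈ pCentralSeries p G (n + 1) :=
  Subgroup.mem_sup_left (Subgroup.commutator_mem_commutator hx (Subgroup.mem_top y))

instance pCentralSeries_normal (n : ℕ) : (pCentralSeries p G n).Normal := by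
  induction n with
  | zero => exact inferInstanceAs (⊤ : Subgroup G).Normal
  | succ n ih =>
    have h : (Subgroup.closure
        ((fun x => x ^ p) '' (pCentralSeries p G n : Set G))).Normal := by
      refine ⟨fun a ha g => ?_⟩
      induction ha using Subgroup.closure_induction with
      | mem x hx =>
        obtain ⟨y, hy, rfl⟩ := hx
        exact Subgroup.subset_closure ⟨g * y * g⁻¹, ih.conj_mem y hy g, by simp⟩
      | one => simp
      | mul x y _ _ hx hy => simpa using mul_mem hx hy
      | inv x _ hx => simpa [mul_assoc] using inv_mem hx
    exact Subgroup.sup_normal _ _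

theorem pCentralSeries_succ_le (n : ℕ) :
    pCentralSeries p G (n + 1) ≤ pCentralSeries p G n := by
  refine sup_le (Subgroup.commutator_le_left _ _) ?_
  rw [Subgroup.closure_le]
  rintro _ ⟨y, hy, rfl⟩
  exact pow_mem hy p

theorem hallWitt (x y z : G) :
    ⁅⁅x, y⁆, y * z * y⁻¹⁆ * ⁅⁅y, z⁆, z * x * z⁻¹⁆ * ⁅⁅z, x⁆, x * y * x⁻¹⁆ = 1 := by
  simp only [commutatorElement_def]
  group

theorem comm_mem_pCentralSeries (m : ℕ) : ∀ (n : ℕ) {x y : G},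
    x ∈ pCentralSeries p G n → y ∈ pCentralSeries p G m →
    ⁅x, y⁆ ∈ pCentralSeries p G (n + m + 1) := by
  induction m with
  | zero => exact fun n x y hx _ => comm_mem_pCentralSeries_succ hx y
  | succ m ih =>
    intro n x y hx hy
    set N := pCentralSeries p G (n + m + 2) with hN
    have key : pCentralSeries p G (m + 1) ≤
        (Subgroup.centralizer ((QuotientGroup.mk' N) '' (pCentralSeries p G n : Set G))).comap
          (QuotientGroup.mk' N) := by
      have conv : ∀ g : G, (∀ w ∈ pCentralSeries p G n, ⁅w, g⁆ ∈ N) →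
          g ∈ (Subgroup.centralizer
            ((QuotientGroup.mk' N) '' (pCentralSeries p G n : Set G))).comap
              (QuotientGroup.mk' N) := by
        rintro g hg
        rw [Subgroup.mem_comap, Subgroup.mem_centralizer_iff]
        rintro _ ⟨w, hw, rfl⟩
        rw [← commutatorElement_eq_one_iff_mul_comm, ← map_commutatorElement]
        exact (QuotientGroup.eq_one_iff _).2 (hg w hw)
      refine sup_le ?_ ?_
      · rw [Subgroup.commutator_le]
        intro g hg h _
        refine conv _ fun w hw => ?_
        have hw' : h⁻¹ * w * h ∈ pCentralSeries p G n := by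
          simpa using (pCentralSeries_normal (p := p) (G := G) n).conj_mem w hw h⁻¹
        have e := hallWitt g h (h⁻¹ * w * h)
        have e1 : h * (h⁻¹ * w * h) * h⁻¹ = w := by group
        rw [e1] at e
        set u := h⁻¹ * w * h with hu
        have m2 : ⁅⁅h, u⁆, u * g * u⁻¹⁆ ∈ N := by
          have a1 : ⁅h, u⁆ ∈ pCentralSeries p G (n + 1) := by
            rw [← commutatorElement_inv]
            exact inv_mem (comm_mem_pCentralSeries_succ hw' h)
          have := ih (n + 1) a1 ((pCentralSeries_normal (p := p) (G := G) m).conj_mem g hg u)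
          rwa [show n + 1 + m + 1 = n + m + 2 by ring] at this
        have m3 : ⁅⁅u, g⁆, g * h * g⁻¹⁆ ∈ N := comm_mem_pCentralSeries_succ (ih n hw' hg) _
        have m1 : ⁅⁅g, h⁆, w⁆ ∈ N := by
          have : ⁅⁅g, h⁆, w⁆ = (⁅⁅u, g⁆, g * h * g⁻¹⁆)⁻¹ * (⁅⁅h, u⁆, u * g * u⁻¹⁆)⁻¹ := by
            rw [← mul_inv_rev, eq_inv_iff_mul_eq_one, ← mul_assoc, e]
          rw [this]
          exact mul_mem (inv_mem m3) (inv_mem m2)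
        rw [← commutatorElement_inv]
        exact inv_mem m1
      · rw [Subgroup.closure_le]
        rintro _ ⟨g, hg, rfl⟩
        refine conv _ fun w hw => ?_
        have hc : ⁅w, g⁆ ∈ pCentralSeries p G (n + m + 1) := ih n hw hg
        have hcN : (QuotientGroup.mk' N) (⁅w, g⁆ ^ p) = 1 :=
          (QuotientGroup.eq_one_iff _).2 (pow_mem_pCentralSeries hc)
        have hcc : (QuotientGroup.mk' N) ⁅⁅w, g⁆, g⁆ = 1 :=
          (QuotientGroup.eq_one_iff _).2 (comm_mem_pCentralSeries_succ hc g)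
        rw [map_commutatorElement, commutatorElement_eq_one_iff_commute] at hcc
        refine (QuotientGroup.eq_one_iff _).1 ?_
        have e : w * g * w⁻¹ = ⁅w, g⁆ * g := by simp [commutatorElement_def]
        have e2 : ⁅w, g ^ p⁆ = (⁅w, g⁆ * g) ^ p * (g ^ p)⁻¹ := by
          rw [← e, conj_pow, commutatorElement_def]
        change (QuotientGroup.mk' N) _ = 1
        rw [e2, map_mul, map_pow, map_mul, hcc.mul_pow, ← map_pow, hcN, map_inv, map_pow]
        simp
    have h := key hy
    rw [Subgroup.mem_comap, Subgroup.mem_centralizer_iff] at h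
    have h' := h _ ⟨x, hx, rfl⟩
    rw [← commutatorElement_eq_one_iff_mul_comm, ← map_commutatorElement] at h'
    exact (QuotientGroup.eq_one_iff _).1 h'

variable (p G)

/-- The group `Gⁿ⁺¹ / Gⁿ⁺²`, written additively. -/
def PLayer (n : ℕ) : Type _ :=
  Additive (pCentralSeries p G n ⧸ (pCentralSeries p G (n + 1)).subgroupOf (pCentralSeries p G n))

variable {p G}

/-- The class in `Gⁿ⁺¹ / Gⁿ⁺²` of an element of `Gⁿ⁺¹`. -/
def pcls {n : ℕ} (x : pCentralSeries p G n) : PLayer p G n :=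
  Additive.ofMul (QuotientGroup.mk x)

instance (n : ℕ) : AddCommGroup (PLayer p G n) :=
  { (inferInstance : AddGroup (Additive (pCentralSeries p G n ⧸
      (pCentralSeries p G (n + 1)).subgroupOf (pCentralSeries p G n)))) with
    add_comm := by
      intro a b
      obtain ⟨x, rfl⟩ := QuotientGroup.mk_surjective a
      obtain ⟨y, rfl⟩ := QuotientGroup.mk_surjective b
      refine (QuotientGroup.eq (s := (pCentralSeries p G (n + 1)).subgroupOf _)).2 ?_
      rw [Subgroup.mem_subgroupOf]
      have := comm_mem_pCentralSeries_succ (p := p) (inv_mem y.2) (x : G)⁻¹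
      simpa [commutatorElement_def, mul_assoc] using this }

theorem pcls_surjective {n : ℕ} : Function.Surjective (pcls : pCentralSeries p G n → PLayer p G n) :=
  fun a => QuotientGroup.mk_surjective (s := (pCentralSeries p G (n + 1)).subgroupOf _) a

theorem pcls_mul {n : ℕ} (x y : pCentralSeries p G n) : pcls (x * y) = pcls x + pcls y := rfl

theorem pcls_eq_iff {n : ℕ} {x y : pCentralSeries p G n} :
    pcls x = pcls y ↔ (x : G)⁻¹ * y ∈ pCentralSeries p G (n + 1) :=
  (QuotientGroup.eq (s := (pCentralSeries p G (n + 1)).subgroupOf _)).trans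
    (by rw [Subgroup.mem_subgroupOf]; rfl)

theorem pcls_eq_zero_iff {n : ℕ} {x : pCentralSeries p G n} :
    pcls x = 0 ↔ (x : G) ∈ pCentralSeries p G (n + 1) :=
  (QuotientGroup.eq_one_iff (N := (pCentralSeries p G (n + 1)).subgroupOf _) x).trans
    Subgroup.mem_subgroupOf

theorem PLayer.nsmul_eq_zero {n : ℕ} (a : PLayer p G n) : p • a = 0 := by
  obtain ⟨x, rfl⟩ := pcls_surjective a
  have : p • pcls x = pcls (x ^ p) := rfl
  rw [this, pcls_eq_zero_iff]
  exact pow_mem_pCentralSeries x.2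

instance (n : ℕ) : Module (ZMod p) (PLayer p G n) :=
  AddCommGroup.zmodModule PLayer.nsmul_eq_zero

/-- The commutator of an element of `Gⁿ⁺¹` and an element of `Gᵐ⁺¹`, as an element of
`Gⁿ⁺ᵐ⁺²`. -/
def pcomm {n m : ℕ} (x : pCentralSeries p G n) (y : pCentralSeries p G m) :
    pCentralSeries p G (n + m + 1) :=
  ⟨⁅(x : G), (y : G)⁆, comm_mem_pCentralSeries m n x.2 y.2⟩

theorem pcls_pcomm_mul_right {n m : ℕ} (x : pCentralSeries p G n) (y z : pCentralSeries p G m) :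
    pcls (pcomm x (y * z)) = pcls (pcomm x y) + pcls (pcomm x z) := by
  rw [← pcls_mul, pcls_eq_iff]
  have h := inv_mem (comm_mem_pCentralSeries_succ (p := p)
    (inv_mem (comm_mem_pCentralSeries m n x.2 z.2)) (y : G))
  convert h using 1
  simp only [pcomm, Subgroup.coe_mul, commutatorElement_def]
  group

theorem pcls_pcomm_mul_left {n m : ℕ} (x y : pCentralSeries p G n) (z : pCentralSeries p G m) :
    pcls (pcomm (x * y) z) = pcls (pcomm x z) + pcls (pcomm y z) := by
  rw [add_comm (pcls (pcomm x z)), ← pcls_mul, pcls_eq_iff]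
  have h := (pCentralSeries_normal (p := p) (G := G) _).conj_mem _
    (inv_mem (comm_mem_pCentralSeries_succ (p := p)
      (inv_mem (comm_mem_pCentralSeries m n y.2 z.2)) (x : G))) ⁅(x : G), (z : G)⁆⁻¹
  convert h using 1
  simp only [pcomm, Subgroup.coe_mul, commutatorElement_def]
  group

theorem pcls_pcomm_eq_zero_right {n m : ℕ} (x : pCentralSeries p G n)
    {y : pCentralSeries p G m} (hy : (y : G) ∈ pCentralSeries p G (m + 1)) :
    pcls (pcomm x y) = 0 :=
  pcls_eq_zero_iff.2 (comm_mem_pCentralSeries (m + 1) n x.2 hy)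

theorem pcls_pcomm_eq_zero_left {n m : ℕ} {x : pCentralSeries p G n}
    (hx : (x : G) ∈ pCentralSeries p G (n + 1)) (y : pCentralSeries p G m) :
    pcls (pcomm x y) = 0 := by
  have h := comm_mem_pCentralSeries m (n + 1) hx y.2
  rw [show n + 1 + m + 1 = n + m + 1 + 1 by ring] at h
  exact pcls_eq_zero_iff.2 h

/-- The biadditive map `Gⁿ⁺¹/Gⁿ⁺² × Gᵐ⁺¹/Gᵐ⁺² → Gⁿ⁺ᵐ⁺²/Gⁿ⁺ᵐ⁺³` induced by the commutator. -/
def layerBracket (n m : ℕ) : PLayer p G n →+ PLayer p G m →+ PLayer p G (n + m + 1) :=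
  MonoidHom.toAdditiveLeft (QuotientGroup.lift _
    (MonoidHom.mk' (fun x => Multiplicative.ofAdd
      (MonoidHom.toAdditiveLeft (QuotientGroup.lift _
        (MonoidHom.mk' (fun y => Multiplicative.ofAdd (pcls (pcomm x y)))
          fun y z => congrArg Multiplicative.ofAdd (pcls_pcomm_mul_right x y z))
        fun _ hy => congrArg Multiplicative.ofAdd
          (pcls_pcomm_eq_zero_right x (Subgroup.mem_subgroupOf.1 hy))) :
        PLayer p G m →+ PLayer p G (n + m + 1)))
      fun x x' => congrArg Multiplicative.ofAdd (AddMonoidHom.ext fun b => by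
        obtain ⟨y, rfl⟩ := pcls_surjective b
        exact pcls_pcomm_mul_left x x' y))
    fun _ hx => congrArg Multiplicative.ofAdd (AddMonoidHom.ext fun b => by
        obtain ⟨y, rfl⟩ := pcls_surjective b
        exact pcls_pcomm_eq_zero_left (Subgroup.mem_subgroupOf.1 hx) y))

theorem layerBracket_pcls {n m : ℕ} (x : pCentralSeries p G n) (y : pCentralSeries p G m) :
    layerBracket n m (pcls x) (pcls y) = pcls (pcomm x y) := rfl

variable (p G)

/-- The Lie algebra over `𝔽_p` of the `p`-central series: the direct sum of the layers
`Gⁿ⁺¹ / Gⁿ⁺²`, with the bracket induced by the commutator of `G`. -/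
def PCentralLie : Type _ := DirectSum ℕ (PLayer p G)

namespace PCentralLie

noncomputable instance : AddCommGroup (PCentralLie p G) :=
  inferInstanceAs (AddCommGroup (DirectSum ℕ (PLayer p G)))

noncomputable instance : Module (ZMod p) (PCentralLie p G) :=
  inferInstanceAs (Module (ZMod p) (DirectSum ℕ (PLayer p G)))

variable {p G}

/-- The inclusion of a layer. -/
noncomputable def of (n : ℕ) : PLayer p G n →+ PCentralLie p G :=
  DirectSum.of (PLayer p G) n

variable (p G) in
/-- The bracket as a biadditive map. -/
noncomputable def bracketHom : PCentralLie p G →+ PCentralLie p G →+ PCentralLie p G :=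
  DirectSum.toAddMonoid fun n => AddMonoidHom.flip (DirectSum.toAddMonoid fun m =>
    AddMonoidHom.flip ((AddMonoidHom.compHom (of (n + m + 1))).comp (layerBracket n m)))

theorem bracketHom_of {n m : ℕ} (a : PLayer p G n) (b : PLayer p G m) :
    bracketHom p G (of n a) (of m b) = of (n + m + 1) (layerBracket n m a b) := by
  unfold bracketHom of
  erw [DirectSum.toAddMonoid_of, AddMonoidHom.flip_apply, DirectSum.toAddMonoid_of]
  rfl

theorem induction {P : PCentralLie p G → Prop} (a : PCentralLie p G)
    (h : ∀ n (x : pCentralSeries p G n), P (of n (pcls x)))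
    (hadd : ∀ a b, P a → P b → P (a + b)) : P a := by
  refine DirectSum.induction_on (motive := P) a ?_ ?_ hadd
  · have := h 0 1
    rwa [show (pcls (1 : pCentralSeries p G 0)) = 0 from rfl, map_zero] at this
  · intro n b
    obtain ⟨x, rfl⟩ := pcls_surjective b
    exact h n x

theorem of_pcls_congr {n m : ℕ} (e : n = m) {x : pCentralSeries p G n} {y : pCentralSeries p G m}
    (h : (x : G)⁻¹ * y ∈ pCentralSeries p G (n + 1)) : of n (pcls x) = of m (pcls y) := by
  subst e
  rw [pcls_eq_iff.2 h]

theorem of_pcls_add_three {i j k : ℕ} (e : j = i) (e' : k = i) {x : pCentralSeries p G i}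
    {y : pCentralSeries p G j} {z : pCentralSeries p G k} (h : (x : G) * y * z = 1) :
    of i (pcls x) + of j (pcls y) + of k (pcls z) = 0 := by
  subst e e'
  rw [← map_add, ← map_add, ← pcls_mul, ← pcls_mul, pcls_eq_zero_iff.2, map_zero]
  rw [Subgroup.coe_mul, Subgroup.coe_mul, h]
  exact one_mem _

theorem bracketHom_pcls {n m : ℕ} (x : pCentralSeries p G n) (y : pCentralSeries p G m) :
    bracketHom p G (of n (pcls x)) (of m (pcls y)) = of (n + m + 1) (pcls (pcomm x y)) :=
  bracketHom_of _ _

theorem bracketHom_skew (a b : PCentralLie p G) :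
    bracketHom p G a b = - bracketHom p G b a := by
  induction a using induction with
  | hadd a a' h h' => rw [map_add, AddMonoidHom.add_apply, h, h', map_add, neg_add]
  | h n x =>
    induction b using induction with
    | hadd b b' h h' => rw [map_add, AddMonoidHom.map_add, AddMonoidHom.add_apply, h, h', neg_add]
    | h m y =>
      rw [bracketHom_pcls, bracketHom_pcls, ← map_neg]
      refine of_pcls_congr (y := (pcomm y x)⁻¹) (by ring) ?_
      rw [show (((pcomm y x)⁻¹ : pCentralSeries p G (m + n + 1)) : G) = (pcomm x y : G) from
        commutatorElement_inv _ _, inv_mul_cancel]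
      exact one_mem _

theorem bracketHom_self (a : PCentralLie p G) : bracketHom p G a a = 0 := by
  induction a using induction with
  | hadd a a' h h' =>
    rw [map_add, map_add, AddMonoidHom.add_apply, AddMonoidHom.add_apply, h, h',
      bracketHom_skew a a']
    simp
  | h n x =>
    rw [bracketHom_pcls, pcls_eq_zero_iff.2, map_zero]
    simp only [pcomm, commutatorElement_self]
    exact one_mem _

theorem bracketHom_jacobi (a b c : PCentralLie p G) :
    bracketHom p G (bracketHom p G a b) c + bracketHom p G (bracketHom p G b c) a +
      bracketHom p G (bracketHom p G c a) b = 0 := by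
  induction a using induction with
  | hadd a a' h h' =>
    simp only [map_add, AddMonoidHom.add_apply]
    rw [← add_zero (0 : PCentralLie p G)]
    nth_rewrite 1 [← h]
    rw [← h']
    abel
  | h n x =>
    induction b using induction with
    | hadd b b' h h' =>
      simp only [map_add, AddMonoidHom.add_apply]
      rw [← add_zero (0 : PCentralLie p G)]
      nth_rewrite 1 [← h]
      rw [← h']
      abel
    | h m y =>
      induction c using induction with
      | hadd c c' h h' =>
        simp only [map_add, AddMonoidHom.add_apply]
        rw [← add_zero (0 : PCentralLie p G)]
        nth_rewrite 1 [← h]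
        rw [← h']
        abel
      | h l z =>
        have conj : ∀ {i j : ℕ} (u : pCentralSeries p G i) (v : pCentralSeries p G j),
            of j (pcls v) = of j (pcls (⟨u * v * (u : G)⁻¹,
              (pCentralSeries_normal j).conj_mem _ v.2 _⟩ : pCentralSeries p G j)) := by
          intro i j u v
          refine of_pcls_congr rfl ?_
          have := comm_mem_pCentralSeries_succ (p := p) (inv_mem v.2) (u : G)
          simpa [commutatorElement_def, mul_assoc] using this
        have h₁ : bracketHom p G (of _ (pcls (pcomm x y))) (of l (pcls z)) = _ :=
          (congrArg _ (conj y z)).trans (bracketHom_pcls _ _)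
        have h₂ : bracketHom p G (of _ (pcls (pcomm y z))) (of n (pcls x)) = _ :=
          (congrArg _ (conj z x)).trans (bracketHom_pcls _ _)
        have h₃ : bracketHom p G (of _ (pcls (pcomm z x))) (of m (pcls y)) = _ :=
          (congrArg _ (conj x y)).trans (bracketHom_pcls _ _)
        rw [bracketHom_pcls x y, bracketHom_pcls y z, bracketHom_pcls z x, h₁, h₂, h₃]
        exact of_pcls_add_three (by ring) (by ring) (hallWitt (x : G) (y : G) (z : G))

noncomputable instance : LieRing (PCentralLie p G) where
  bracket a b := bracketHom p G a b
  add_lie a b c := by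
    change bracketHom p G (a + b) c = _
    rw [map_add]; rfl
  lie_add a b c := map_add _ _ _
  lie_self := bracketHom_self
  leibniz_lie a b c := by
    have h := bracketHom_jacobi a b c
    change bracketHom p G a (bracketHom p G b c) = bracketHom p G (bracketHom p G a b) c +
      bracketHom p G b (bracketHom p G a c)
    rw [bracketHom_skew (bracketHom p G b c) a, bracketHom_skew (bracketHom p G c a) b,
      bracketHom_skew c a, map_neg, neg_neg] at h
    rw [← sub_eq_zero, ← neg_eq_zero, ← h]
    abel

noncomputable instance : LieAlgebra (ZMod p) (PCentralLie p G) where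
  lie_smul t a b := ZMod.map_smul (bracketHom p G a) t b

end PCentralLie

end PCentral

/-! ### Sah's group -/

section Sah

/-- The ring `R = F ⊕ Fπ ⊕ Fπ²` of truncated twisted polynomials, with `π f = σ(f) π` for `f ∈ F`
and `π³ = 0`; the element `⟨a, b, c⟩` is `a + bπ + cπ²`. -/
@[ext]
structure TwistedRing (F : Type*) [Field F] (σ : F →+* F) where
  /-- the coefficient of `1` -/
  c₀ : F
  /-- the coefficient of `π` -/
  c₁ : F
  /-- the coefficient of `π²` -/
  c₂ : F

namespace TwistedRing

variable {F : Type*} [Field F] {σ : F →+* F}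

instance : Zero (TwistedRing F σ) := ⟨⟨0, 0, 0⟩⟩
instance : One (TwistedRing F σ) := ⟨⟨1, 0, 0⟩⟩
instance : Add (TwistedRing F σ) := ⟨fun x y => ⟨x.c₀ + y.c₀, x.c₁ + y.c₁, x.c₂ + y.c₂⟩⟩
instance : Neg (TwistedRing F σ) := ⟨fun x => ⟨-x.c₀, -x.c₁, -x.c₂⟩⟩
instance : Mul (TwistedRing F σ) := ⟨fun x y =>
  ⟨x.c₀ * y.c₀, x.c₀ * y.c₁ + x.c₁ * σ y.c₀,
    x.c₀ * y.c₂ + x.c₁ * σ y.c₁ + x.c₂ * σ (σ y.c₀)⟩⟩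

@[simp] theorem zero_c₀ : (0 : TwistedRing F σ).c₀ = 0 := rfl
@[simp] theorem zero_c₁ : (0 : TwistedRing F σ).c₁ = 0 := rfl
@[simp] theorem zero_c₂ : (0 : TwistedRing F σ).c₂ = 0 := rfl
@[simp] theorem one_c₀ : (1 : TwistedRing F σ).c₀ = 1 := rfl
@[simp] theorem one_c₁ : (1 : TwistedRing F σ).c₁ = 0 := rfl
@[simp] theorem one_c₂ : (1 : TwistedRing F σ).c₂ = 0 := rfl
@[simp] theorem add_c₀ (x y : TwistedRing F σ) : (x + y).c₀ = x.c₀ + y.c₀ := rfl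
@[simp] theorem add_c₁ (x y : TwistedRing F σ) : (x + y).c₁ = x.c₁ + y.c₁ := rfl
@[simp] theorem add_c₂ (x y : TwistedRing F σ) : (x + y).c₂ = x.c₂ + y.c₂ := rfl
@[simp] theorem neg_c₀ (x : TwistedRing F σ) : (-x).c₀ = -x.c₀ := rfl
@[simp] theorem neg_c₁ (x : TwistedRing F σ) : (-x).c₁ = -x.c₁ := rfl
@[simp] theorem neg_c₂ (x : TwistedRing F σ) : (-x).c₂ = -x.c₂ := rfl
@[simp] theorem mul_c₀ (x y : TwistedRing F σ) : (x * y).c₀ = x.c₀ * y.c₀ := rfl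
@[simp] theorem mul_c₁ (x y : TwistedRing F σ) :
    (x * y).c₁ = x.c₀ * y.c₁ + x.c₁ * σ y.c₀ := rfl
@[simp] theorem mul_c₂ (x y : TwistedRing F σ) :
    (x * y).c₂ = x.c₀ * y.c₂ + x.c₁ * σ y.c₁ + x.c₂ * σ (σ y.c₀) := rfl

instance : Ring (TwistedRing F σ) where
  add_assoc x y z := by ext <;> simp [add_assoc]
  zero_add x := by ext <;> simp
  add_zero x := by ext <;> simp
  add_comm x y := by ext <;> simp [add_comm]
  neg_add_cancel x := by ext <;> simp
  mul_assoc x y z := by ext <;> simp <;> ring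
  one_mul x := by ext <;> simp
  mul_one x := by ext <;> simp
  zero_mul x := by ext <;> simp
  mul_zero x := by ext <;> simp
  left_distrib x y z := by ext <;> simp <;> ring
  right_distrib x y z := by ext <;> simp <;> ring
  nsmul := nsmulRec
  zsmul := zsmulRec

variable (F σ) in
/-- The multiplicative group `U₁(R) = 1 + Rπ`. -/
def unitsOne : Subgroup (TwistedRing F σ)ˣ where
  carrier := {u | (u : TwistedRing F σ).c₀ = 1}
  one_mem' := rfl
  mul_mem' := by
    intro u v hu hv
    simp only [Set.mem_ofPred_eq] at hu hv ⊢
    simp [hu, hv]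
  inv_mem' := by
    intro u hu
    simp only [Set.mem_ofPred_eq] at hu ⊢
    have h := congrArg TwistedRing.c₀ u.mul_inv
    rwa [mul_c₀, hu, one_mul, one_c₀] at h

end TwistedRing

/-- The action of `U₁(R)` on the additive group of `R` by left multiplication `r ↦ u r`. -/
def leftMulAction (F : Type*) [Field F] (σ : F →+* F) :
    TwistedRing.unitsOne F σ →* MulAut (Multiplicative (TwistedRing F σ)) where
  toFun u := AddEquiv.toMultiplicative (DistribMulAction.toAddEquiv (TwistedRing F σ)
    (u : (TwistedRing F σ)ˣ))
  map_one' := by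
    refine MulEquiv.ext fun x => ?_
    exact one_mul (Multiplicative.toAdd x)
  map_mul' u v := by
    refine MulEquiv.ext fun x => ?_
    exact mul_assoc _ _ (Multiplicative.toAdd x)

/-- The split extension `(R, +) ⋊ U₁(R)`. -/
abbrev SplitExt (F : Type*) [Field F] (σ : F →+* F) : Type _ :=
  Multiplicative (TwistedRing F σ) ⋊[leftMulAction F σ] TwistedRing.unitsOne F σ

/-- Sah's group `G_p`, of order `p¹⁵`, for the field `F` with `p³` elements and the twist
`π f = f^(pᵉ) π`. -/
abbrev SahGroup (p : ℕ) [Fact p.Prime] (e : ℕ) : Type :=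
  SplitExt (GaloisField p 3) (iterateFrobenius (GaloisField p 3) p e)

end Sah

/-! ### The Lie algebra `𝔤₃` -/

section G3

/-- The underlying vector space `𝔽₃¹⁵` of `𝔤₃`. -/
def G3 : Type := Fin 15 → ZMod 3

namespace G3

instance : AddCommGroup G3 := inferInstanceAs (AddCommGroup (Fin 15 → ZMod 3))
instance : Module (ZMod 3) G3 := inferInstanceAs (Module (ZMod 3) (Fin 15 → ZMod 3))

/-- The basis vectors `v₁, …, v₁₅`. -/
def v (k : ℕ) : G3 := fun i => if i.val + 1 = k then 1 else 0

/-- The listed products `[vᵢ, vⱼ]`, `i < j`. -/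
def table : ℕ → ℕ → G3
  | 1, 2 => 2 • v 7
  | 1, 3 => v 7 + 2 • v 8
  | 1, 4 => 2 • v 10
  | 1, 5 => v 11
  | 1, 6 => v 12
  | 1, 10 => 2 • v 13
  | 1, 11 => v 14 + v 15
  | 1, 12 => 2 • v 15
  | 2, 3 => 2 • v 8 + v 9
  | 2, 4 => 2 • v 12
  | 2, 5 => 2 • v 10 + v 12
  | 2, 6 => v 11
  | 2, 10 => v 13 + 2 • v 15
  | 2, 11 => v 13 + 2 • v 14 + v 15
  | 2, 12 => v 14 + 2 • v 15
  | 3, 4 => 2 • v 11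
  | 3, 5 => v 11 + 2 • v 12
  | 3, 6 => 2 • v 10 + v 12
  | 3, 10 => 2 • v 13 + v 14
  | 3, 11 => v 13 + 2 • v 14 + 2 • v 15
  | 3, 12 => v 13 + v 14 + 2 • v 15
  | 4, 7 => v 13
  | 4, 8 => 2 • v 15
  | 4, 9 => v 14 + v 15
  | 5, 7 => v 14 + v 15
  | 5, 8 => 2 • v 13 + v 15
  | 5, 9 => 2 • v 14 + v 15
  | 6, 7 => 2 • v 15
  | 6, 8 => 2 • v 14 + 2 • v 15
  | 6, 9 => 2 • v 13 + v 15
  | _, _ => 0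

/-- The product `[vᵢ₊₁, vⱼ₊₁]` of arbitrary basis vectors. -/
def basisBracket (i j : Fin 15) : G3 := table (i + 1) (j + 1) - table (j + 1) (i + 1)

/-- The bilinear extension of the products of basis vectors. -/
def bracketLin : G3 →ₗ[ZMod 3] G3 →ₗ[ZMod 3] G3 :=
  LinearMap.mk₂ (ZMod 3) (fun x y => ∑ i : Fin 15, ∑ j : Fin 15, (x i * y j) • basisBracket i j)
    (fun x x' y => by
      simp only [← Finset.sum_add_distrib, ← add_smul, ← add_mul]; rfl)
    (fun t x y => by
      simp only [Finset.smul_sum, smul_smul, ← mul_assoc]; rfl)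
    (fun x y y' => by
      simp only [← Finset.sum_add_distrib, ← add_smul, ← mul_add]; rfl)
    (fun t x y => by
      simp only [Finset.smul_sum, smul_smul, mul_left_comm t]; rfl)

theorem bracketLin_self (x : G3) : bracketLin x x = 0 := by
  change ∑ i : Fin 15, ∑ j : Fin 15, (x i * x j) • basisBracket i j = 0
  simp only [basisBracket, smul_sub, Finset.sum_sub_distrib]
  rw [sub_eq_zero, Finset.sum_comm]
  simp only [mul_comm]

instance : DecidableEq G3 := inferInstanceAs (DecidableEq (Fin 15 → ZMod 3))

theorem bracketLin_v (i : Fin 15) (y : G3) :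
    bracketLin (v (i + 1)) y = ∑ j : Fin 15, y j • basisBracket i j := by
  change ∑ k : Fin 15, ∑ j : Fin 15, (v (i + 1) k * y j) • basisBracket k j = _
  rw [Finset.sum_eq_single i]
  · simp [v]
  · intro k _ hk
    have : ¬ (k : ℕ) = i := fun h => hk (Fin.ext h)
    simp [v, this]
  · simp

theorem bracketLin_v_v (i j : Fin 15) :
    bracketLin (v (i + 1)) (v (j + 1)) = basisBracket i j := by
  rw [bracketLin_v, Finset.sum_eq_single j]
  · simp [v]
  · intro k _ hk
    have : ¬ (k : ℕ) = j := fun h => hk (Fin.ext h)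
    simp [v, this]
  · simp

/-- The structure constants. -/
def structureConst (i j k : Fin 15) : ZMod 3 := basisBracket i j k

theorem structureConst_eq_zero : ∀ i j k : Fin 15,
    (k < 6 ∨ (k < 12 ∧ (6 ≤ i ∨ 6 ≤ j))) → structureConst i j k = 0 := by
  decide +kernel

theorem basisBracket_eq_zero : ∀ i j : Fin 15,
    ((6 ≤ i ∧ 6 ≤ j) ∨ 12 ≤ j) → basisBracket i j = 0 := by
  decide +kernel

theorem bracketLin_basisBracket_eq_zero {i j k : Fin 15} (h : 6 ≤ i ∨ 6 ≤ j ∨ 6 ≤ k) :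
    bracketLin (v (i + 1)) (basisBracket j k) = 0 := by
  rw [bracketLin_v]
  refine Finset.sum_eq_zero fun m _ => ?_
  by_cases hm : 12 ≤ m
  · rw [basisBracket_eq_zero i m (Or.inr hm), smul_zero]
  rcases h with h | h
  · by_cases hm' : 6 ≤ m
    · rw [basisBracket_eq_zero i m (Or.inl ⟨h, hm'⟩), smul_zero]
    · rw [show basisBracket j k m = 0 from structureConst_eq_zero j k m (Or.inl (not_le.1 hm')),
        zero_smul]
  · rw [show basisBracket j k m = 0 from structureConst_eq_zero j k m (Or.inr ⟨not_le.1 hm, h⟩),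
      zero_smul]

theorem jacobi_small : ∀ i j k : Fin 6,
    ∑ m : Fin 15, (basisBracket (j.castLE (by lia)) (k.castLE (by lia)) m : ZMod 3) •
        basisBracket (i.castLE (by lia)) m +
      ∑ m : Fin 15, (basisBracket (k.castLE (by lia)) (i.castLE (by lia)) m : ZMod 3) •
        basisBracket (j.castLE (by lia)) m +
      ∑ m : Fin 15, (basisBracket (i.castLE (by lia)) (j.castLE (by lia)) m : ZMod 3) •
        basisBracket (k.castLE (by lia)) m = 0 := by
  decide +kernel

theorem jacobi_basis (i j k : Fin 15) :
    bracketLin (v (i + 1)) (basisBracket j k) + bracketLin (v (j + 1)) (basisBracket k i) +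
      bracketLin (v (k + 1)) (basisBracket i j) = 0 := by
  by_cases h : 6 ≤ i ∨ 6 ≤ j ∨ 6 ≤ k
  · rw [bracketLin_basisBracket_eq_zero h, bracketLin_basisBracket_eq_zero (by tauto),
      bracketLin_basisBracket_eq_zero (by tauto), add_zero, add_zero]
  · simp only [not_or, not_le] at h
    rw [bracketLin_v, bracketLin_v, bracketLin_v]
    exact jacobi_small ⟨i, h.1⟩ ⟨j, h.2.1⟩ ⟨k, h.2.2⟩

theorem hom_ext {M : Type*} [AddCommGroup M] [Module (ZMod 3) M] {f g : G3 →ₗ[ZMod 3] M}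
    (h : ∀ i : Fin 15, f (v (i + 1)) = g (v (i + 1))) : f = g := by
  refine LinearMap.pi_ext' fun i => LinearMap.ext_ring ?_
  have : v (i + 1) = (Pi.single i 1 : Fin 15 → ZMod 3) := by
    funext j
    simp [v, Pi.single_apply, Fin.ext_iff]
  have h' := h i
  rw [this] at h'
  exact h'

theorem bracketLin_skew (x y : G3) : bracketLin x y = - bracketLin y x := by
  have h := bracketLin_self (x + y)
  simp only [map_add, LinearMap.add_apply, bracketLin_self] at h
  rw [eq_neg_iff_add_eq_zero]
  simpa [add_comm] using h

theorem jacobi (x y z : G3) :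
    bracketLin x (bracketLin y z) + bracketLin y (bracketLin z x) +
      bracketLin z (bracketLin x y) = 0 := by
  have e₃ : ∀ i j : Fin 15, ∀ z, bracketLin (v (i + 1)) (bracketLin (v (j + 1)) z) +
      bracketLin (v (j + 1)) (bracketLin z (v (i + 1))) +
      bracketLin z (bracketLin (v (i + 1)) (v (j + 1))) = 0 := fun i j z =>
    LinearMap.congr_fun (hom_ext (M := G3)
      (f := bracketLin (v (i + 1)) ∘ₗ bracketLin (v (j + 1)) +
        bracketLin (v (j + 1)) ∘ₗ bracketLin.flip (v (i + 1)) +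
        bracketLin.flip (bracketLin (v (i + 1)) (v (j + 1)))) (g := 0) fun k => by
          simpa [bracketLin_v_v] using jacobi_basis i j k) z
  have e₂ : ∀ i : Fin 15, ∀ y z, bracketLin (v (i + 1)) (bracketLin y z) +
      bracketLin y (bracketLin z (v (i + 1))) +
      bracketLin z (bracketLin (v (i + 1)) y) = 0 := fun i y z =>
    LinearMap.congr_fun (hom_ext (M := G3)
      (f := bracketLin (v (i + 1)) ∘ₗ bracketLin.flip z +
        bracketLin.flip (bracketLin z (v (i + 1))) +
        bracketLin z ∘ₗ bracketLin (v (i + 1))) (g := 0) fun j => by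
          simpa using e₃ i j z) y
  exact LinearMap.congr_fun (hom_ext (M := G3)
      (f := bracketLin.flip (bracketLin y z) + bracketLin y ∘ₗ bracketLin z +
        bracketLin z ∘ₗ bracketLin.flip y) (g := 0) fun i => by
          simpa using e₂ i y z) x

instance : LieRing G3 where
  bracket x y := bracketLin x y
  add_lie x y z := by
    change bracketLin (x + y) z = _
    rw [map_add]; rfl
  lie_add x y z := map_add _ _ _
  lie_self := bracketLin_self
  leibniz_lie x y z := by
    change bracketLin x (bracketLin y z) = bracketLin (bracketLin x y) z +
      bracketLin y (bracketLin x z)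
    have h := jacobi x y z
    rw [bracketLin_skew z x, map_neg, bracketLin_skew z] at h
    rw [← sub_eq_zero, ← h]
    abel

instance : LieAlgebra (ZMod 3) G3 where
  lie_smul t x y := map_smul (bracketLin x) t y

/-- The listed values of `d₁` on the basis vectors. -/
def d₁Table : ℕ → G3
  | 2 => v 7
  | 3 => 2 • v 7 + v 8
  | 4 => 2 • v 11 + 2 • v 12
  | 5 => 2 • v 10
  | 6 => v 10
  | 10 => v 14
  | 11 => v 13
  | 12 => 2 • v 13
  | _ => 0

/-- The listed values of `d₂` on the basis vectors. -/
def d₂Table : ℕ → G3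
  | 2 => v 10
  | 7 => v 13
  | 8 => v 13
  | 9 => 2 • v 13 + 2 • v 14
  | _ => 0

/-- The linear map `d₁`. -/
def d₁ : G3 →ₗ[ZMod 3] G3 where
  toFun x := ∑ i : Fin 15, x i • d₁Table (i + 1)
  map_add' x y := by
    simp only [← Finset.sum_add_distrib, ← add_smul]; rfl
  map_smul' t x := by
    simp only [RingHom.id_apply, Finset.smul_sum, smul_smul]; rfl

/-- The linear map `d₂`. -/
def d₂ : G3 →ₗ[ZMod 3] G3 where
  toFun x := ∑ i : Fin 15, x i • d₂Table (i + 1)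
  map_add' x y := by
    simp only [← Finset.sum_add_distrib, ← add_smul]; rfl
  map_smul' t x := by
    simp only [RingHom.id_apply, Finset.smul_sum, smul_smul]; rfl

end G3

end G3

/-!
The proof is uniform in the prime `p` and works over any field `F` of dimension three over `𝔽_p`
with an endomorphism `σ` of order three; the groups in question are the case `σ = Frobᵉ`,
`e ∈ {1, 2}` (`isCubicTwist_iterateFrobenius`).

In the split extension the coordinates of degree one are the coefficient `a` of `π` in `U₁(R)` and
the coefficient `r` of `1` in `R`, those of degree two are the next coefficients `b` and `s`, and
`z`, the coefficient of `π²` in `R`, has degree three. The `p`-central series is the filtration by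
this degree (`SplitExt.pCentralSeries_eq_filt`), so the Lie algebra is the graded algebra
`TwistLie σ` on `F⁵` with
`[a, a'] = a σ(a') - a' σ(a)`, `[a, r] = a σ(r)`, `[a, s] = a σ(s)`, `[b, r] = b σ²(r)`
(`SplitExt.pCentralLieEquiv`).

Every additive endomorphism of `F` is uniquely of the form `k₀ + k₁ σ + k₂ σ²`, and the products
`σⁱ x · σʲ y` are linearly independent over `F`. Comparing their coefficients in the Leibniz rule
turns the computation of derivations into linear algebra over `F` with few unknowns: a derivation
without `a ↦ r` part, which for odd `p` is any derivation, is given by `15` parameters in `F`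
(`TwistLie.exists_eq_der`). The inner ones form an `F⁴`. For the almost-inner ones the only
condition that is not plainly linear is that the part `k₀ + k₁ σ` of `a ↦ b` satisfies
`k₀ x + k₁ σ(x) ∈ {y σ(x) - x σ(y)}` for all `x`; after division by `x σ(x)` the right side consists
of elements of trace zero, which forces `k₀ = -σ(k₁)`. This leaves an `F¹¹`
(`TwistLie.exists_eq_aidDer`), and all of it is almost inner: `[L, x]` contains all of degree three
as soon as `x` has a non-zero coordinate of degree one, and the remaining `x` are easy
(`TwistLie.aidDer_mem_AID`).

The bracket of two almost-inner derivations is `TwistLie.lie_aidDer`; its coefficient of `σ` in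
`a ↦ z`, which vanishes for inner derivations, is non-zero in general. The complement `U`
consists of almost-inner derivations that annihilate the vector with `a = 1` (`TwistLie.compl`).

For `p = 3`, a root `α` of `X³ - X - 1` with `σ(α) = α - 1` gives the basis `1, α, α²` of `F`, in
which the isomorphism with `𝔤₃` and the identification of `d₁` and `d₂` are finite verifications.
-/

/-! ### Additive maps of a cyclic cubic extension -/

/-- `σ` is an endomorphism of order three of the field `F`. -/
class IsCubicTwist {F : Type*} [Field F] (σ : F →+* F) : Prop where
  cube : ∀ x, σ (σ (σ x)) = x
  exists_ne : ∃ x, σ x ≠ x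

section CubicTwist

variable {F : Type*} [Field F] {σ : F →+* F}

variable (p : ℕ) [Fact p.Prime] [Algebra (ZMod p) F] (σ) in
/-- The map `(k₀, k₁, k₂) ↦ k₀ + k₁ σ + k₂ σ²` to the additive endomorphisms of `F`. -/
def twistPoly : (Fin 3 → F) →ₗ[ZMod p] F →ₗ[ZMod p] F :=
  AddMonoidHom.toZModLinearMap p
    { toFun := fun k => AddMonoidHom.toZModLinearMap p
        { toFun := fun x => k 0 * x + k 1 * σ x + k 2 * σ (σ x)
          map_zero' := by simp
          map_add' := fun x y => by simp only [map_add]; ring }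
      map_zero' := by ext; simp
      map_add' := fun k l => by
        ext x
        simp only [AddMonoidHom.coe_toZModLinearMap, AddMonoidHom.coe_mk, ZeroHom.coe_mk,
          Pi.add_apply, LinearMap.add_apply]
        ring }

variable [hσ : IsCubicTwist σ]

@[simp]
theorem twist_cube (x : F) : σ (σ (σ x)) = x := hσ.cube x

/-- Dedekind's independence of `1, σ, σ²`. -/
theorem twist_linear_coeff_eq_zero {k₀ k₁ k₂ : F}
    (h : ∀ x, k₀ * x + k₁ * σ x + k₂ * σ (σ x) = 0) : k₀ = 0 ∧ k₁ = 0 ∧ k₂ = 0 := by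
  obtain ⟨w, hw⟩ := hσ.exists_ne
  have hw₂ : σ (σ w) ≠ w := fun h' => hw (by rw [← congrArg σ h', twist_cube])
  have hinj : Function.Injective
      ![MonoidHom.id F, (σ : F →* F), ((σ.comp σ : F →+* F) : F →* F)] := by
    intro i j hij
    have h' := DFunLike.congr_fun hij w
    fin_cases i <;> fin_cases j <;> simp at h' ⊢
    · exact hw h'.symm
    · exact hw₂ h'.symm
    · exact hw h'
    · exact hw (σ.injective h'.symm)
    · exact hw₂ h'
    · exact hw (σ.injective h')
  have hli := (linearIndependent_monoidHom F F).comp _ hinj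
  have := Fintype.linearIndependent_iff.1 hli ![k₀, k₁, k₂] (by
    funext x
    simpa [Fin.sum_univ_three, ← add_assoc] using h x)
  exact ⟨this 0, this 1, this 2⟩

/-- Independence of the nine products `σⁱ x · σʲ y`. -/
theorem twist_bilinear_coeff_eq_zero {k₀₀ k₀₁ k₀₂ k₁₀ k₁₁ k₁₂ k₂₀ k₂₁ k₂₂ : F}
    (h : ∀ x y, k₀₀ * x * y + k₀₁ * x * σ y + k₀₂ * x * σ (σ y) +
      (k₁₀ * σ x * y + k₁₁ * σ x * σ y + k₁₂ * σ x * σ (σ y)) +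
      (k₂₀ * σ (σ x) * y + k₂₁ * σ (σ x) * σ y + k₂₂ * σ (σ x) * σ (σ y)) = 0) :
    (k₀₀ = 0 ∧ k₀₁ = 0 ∧ k₀₂ = 0) ∧ (k₁₀ = 0 ∧ k₁₁ = 0 ∧ k₁₂ = 0) ∧
      (k₂₀ = 0 ∧ k₂₁ = 0 ∧ k₂₂ = 0) := by
  have h' : ∀ y, (k₀₀ * y + k₀₁ * σ y + k₀₂ * σ (σ y) = 0) ∧
      (k₁₀ * y + k₁₁ * σ y + k₁₂ * σ (σ y) = 0) ∧
      (k₂₀ * y + k₂₁ * σ y + k₂₂ * σ (σ y) = 0) := fun y =>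
    twist_linear_coeff_eq_zero (σ := σ) fun x => by linear_combination h x y
  exact ⟨twist_linear_coeff_eq_zero fun y => (h' y).1,
    twist_linear_coeff_eq_zero fun y => (h' y).2.1, twist_linear_coeff_eq_zero fun y => (h' y).2.2⟩

variable {p : ℕ} [Fact p.Prime] [Algebra (ZMod p) F]

/-- Every additive endomorphism of `F` is of the form `k₀ + k₁ σ + k₂ σ²`: these maps form a space
of the full dimension `9`. -/
theorem exists_eq_twistPoly (hF : Module.finrank (ZMod p) F = 3) (f : F →+ F) :
    ∃ k₀ k₁ k₂ : F, ∀ x, f x = k₀ * x + k₁ * σ x + k₂ * σ (σ x) := by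
  have : Module.Finite (ZMod p) F := Module.finite_of_finrank_pos (by omega)
  have hinj : Function.Injective (twistPoly σ p) := by
    rw [injective_iff_map_eq_zero]
    intro k hk
    obtain ⟨h₀, h₁, h₂⟩ := twist_linear_coeff_eq_zero (σ := σ) (k₀ := k 0) (k₁ := k 1) (k₂ := k 2)
      fun x => LinearMap.congr_fun hk x
    funext i
    fin_cases i <;> assumption
  have hsurj := (LinearMap.injective_iff_surjective_of_finrank_eq_finrank (by
    rw [Module.finrank_linearMap, Module.finrank_pi_fintype]
    simp [hF])).1 hinj
  obtain ⟨k, hk⟩ := hsurj (f.toZModLinearMap p)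
  exact ⟨k 0, k 1, k 2, fun x => (LinearMap.congr_fun hk x).symm⟩

/-- The elements `x σ(y) - y σ(x)` span `F`: an additive map vanishing on all of them is zero. -/
theorem addMonoidHom_eq_zero_of_twist_comm (hF : Module.finrank (ZMod p) F = 3) {f : F →+ F}
    (h : ∀ x y, f (x * σ y - y * σ x) = 0) : f = 0 := by
  obtain ⟨k₀, k₁, k₂, hk⟩ := exists_eq_twistPoly (σ := σ) hF f
  obtain ⟨⟨-, h₀, -⟩, ⟨-, -, h₁⟩, ⟨h₂, -, -⟩⟩ := twist_bilinear_coeff_eq_zero (σ := σ)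
    (k₀₀ := 0) (k₀₁ := k₀) (k₀₂ := - k₂) (k₁₀ := - k₀) (k₁₁ := 0) (k₁₂ := k₁) (k₂₀ := k₂)
    (k₂₁ := - k₁) (k₂₂ := 0) fun x y => by
      have := h x y
      rw [hk] at this
      simp only [map_sub, map_mul, twist_cube] at this
      linear_combination this
  ext x
  rw [hk, h₀, h₁, h₂]
  simp

theorem addSubgroup_eq_top_of_twist_comm (hF : Module.finrank (ZMod p) F = 3) {S : AddSubgroup F}
    (h : ∀ x y, x * σ y - y * σ x ∈ S) : S = ⊤ := by
  by_contra hS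
  set S' : Submodule (ZMod p) F := AddSubgroup.toZModSubmodule p S
  have hS' : S' < ⊤ := lt_top_iff_ne_top.2 fun h' => hS (by
    rw [eq_top_iff]
    intro x _
    have : x ∈ S' := h' ▸ Submodule.mem_top
    exact this)
  obtain ⟨f, hf, hle⟩ := Submodule.exists_le_ker_of_lt_top S' hS'
  refine hf ?_
  have := addMonoidHom_eq_zero_of_twist_comm (σ := σ) hF
    (f := ((algebraMap (ZMod p) F : ZMod p →+* F) : ZMod p →+ F).comp f.toAddMonoidHom)
    fun x y => by
      have : f (x * σ y - y * σ x) = 0 := hle (h x y : x * σ y - y * σ x ∈ S')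
      simp [this]
  ext x
  have h' := DFunLike.congr_fun this x
  simpa using h'

variable (σ) in
/-- The trace `1 + σ + σ²`. -/
def twistTrace (x : F) : F := x + σ x + σ (σ x)

/-- The additive form of Hilbert's theorem 90. -/
theorem exists_sub_twist_eq {x : F} (hx : twistTrace σ x = 0) : ∃ c, c - σ c = x := by
  have : ∃ w, twistTrace σ w ≠ 0 := by
    by_contra! hw
    exact one_ne_zero (α := F) (twist_linear_coeff_eq_zero (σ := σ) (k₁ := 1) (k₂ := 1) fun x => by
      simpa [twistTrace] using hw x).1
  obtain ⟨w, hw⟩ := this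
  have ht : σ (twistTrace σ w) = twistTrace σ w := by
    simp only [twistTrace, map_add, twist_cube]; ring
  -- After scaling `w` to have trace `1`, this is the standard cochain `x σ(w) + (x + σ(x)) σ²(w)`.
  refine ⟨(x * σ w + (x + σ x) * σ (σ w)) / twistTrace σ w, ?_⟩
  rw [map_div₀, ht, ← sub_div, div_eq_iff hw]
  simp only [map_add, map_mul, twist_cube]
  unfold twistTrace at hx ⊢
  linear_combination (-w) * hx

end CubicTwist

/-! ### The graded Lie algebra of the twist -/

/-- The graded Lie algebra `F⁵` attached to an endomorphism `σ` of `F`: the coordinates `a, r` have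
degree one, `b, s` degree two and `z` degree three. For Sah's group these are the coefficients of
`π` and `π²` in `U₁(R)` (for `a` and `b`), and of `1, π, π²` in `R` (for `r`, `s` and `z`). -/
@[ext]
structure TwistLie {F : Type*} [Field F] (σ : F →+* F) where
  /-- the coefficient of `π` in `U₁(R)` -/
  a : F
  /-- the coefficient of `1` in `R` -/
  r : F
  /-- the coefficient of `π²` in `U₁(R)` -/
  b : F
  /-- the coefficient of `π` in `R` -/
  s : F
  /-- the coefficient of `π²` in `R` -/
  z : F

namespace TwistLie

section Basic

variable {F : Type*} [Field F] {σ : F →+* F}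

instance : Zero (TwistLie σ) := ⟨⟨0, 0, 0, 0, 0⟩⟩
instance : Add (TwistLie σ) := ⟨fun x y => ⟨x.a + y.a, x.r + y.r, x.b + y.b, x.s + y.s, x.z + y.z⟩⟩
instance : Neg (TwistLie σ) := ⟨fun x => ⟨-x.a, -x.r, -x.b, -x.s, -x.z⟩⟩
instance : Bracket (TwistLie σ) (TwistLie σ) := ⟨fun x y =>
  ⟨0, 0, x.a * σ y.a - y.a * σ x.a, x.a * σ y.r - y.a * σ x.r,
    x.a * σ y.s - y.a * σ x.s + x.b * σ (σ y.r) - y.b * σ (σ x.r)⟩⟩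

@[simp] theorem zero_a : (0 : TwistLie σ).a = 0 := rfl
@[simp] theorem zero_r : (0 : TwistLie σ).r = 0 := rfl
@[simp] theorem zero_b : (0 : TwistLie σ).b = 0 := rfl
@[simp] theorem zero_s : (0 : TwistLie σ).s = 0 := rfl
@[simp] theorem zero_z : (0 : TwistLie σ).z = 0 := rfl
@[simp] theorem add_a (x y : TwistLie σ) : (x + y).a = x.a + y.a := rfl
@[simp] theorem add_r (x y : TwistLie σ) : (x + y).r = x.r + y.r := rfl
@[simp] theorem add_b (x y : TwistLie σ) : (x + y).b = x.b + y.b := rfl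
@[simp] theorem add_s (x y : TwistLie σ) : (x + y).s = x.s + y.s := rfl
@[simp] theorem add_z (x y : TwistLie σ) : (x + y).z = x.z + y.z := rfl
@[simp] theorem neg_a (x : TwistLie σ) : (-x).a = -x.a := rfl
@[simp] theorem neg_r (x : TwistLie σ) : (-x).r = -x.r := rfl
@[simp] theorem neg_b (x : TwistLie σ) : (-x).b = -x.b := rfl
@[simp] theorem neg_s (x : TwistLie σ) : (-x).s = -x.s := rfl
@[simp] theorem neg_z (x : TwistLie σ) : (-x).z = -x.z := rfl
@[simp] theorem lie_a (x y : TwistLie σ) : ⁅x, y⁆.a = 0 := rfl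
@[simp] theorem lie_r (x y : TwistLie σ) : ⁅x, y⁆.r = 0 := rfl
@[simp] theorem lie_b (x y : TwistLie σ) : ⁅x, y⁆.b = x.a * σ y.a - y.a * σ x.a := rfl
@[simp] theorem lie_s (x y : TwistLie σ) : ⁅x, y⁆.s = x.a * σ y.r - y.a * σ x.r := rfl
@[simp] theorem lie_z (x y : TwistLie σ) :
    ⁅x, y⁆.z = x.a * σ y.s - y.a * σ x.s + x.b * σ (σ y.r) - y.b * σ (σ x.r) := rfl

instance : AddCommGroup (TwistLie σ) where
  add_assoc x y z := by ext <;> simp [add_assoc]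
  zero_add x := by ext <;> simp
  add_zero x := by ext <;> simp
  add_comm x y := by ext <;> simp [add_comm]
  neg_add_cancel x := by ext <;> simp
  nsmul := nsmulRec
  zsmul := zsmulRec

@[simp] theorem sub_a (x y : TwistLie σ) : (x - y).a = x.a - y.a := by simp [sub_eq_add_neg]
@[simp] theorem sub_r (x y : TwistLie σ) : (x - y).r = x.r - y.r := by simp [sub_eq_add_neg]
@[simp] theorem sub_b (x y : TwistLie σ) : (x - y).b = x.b - y.b := by simp [sub_eq_add_neg]
@[simp] theorem sub_s (x y : TwistLie σ) : (x - y).s = x.s - y.s := by simp [sub_eq_add_neg]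
@[simp] theorem sub_z (x y : TwistLie σ) : (x - y).z = x.z - y.z := by simp [sub_eq_add_neg]

instance : LieRing (TwistLie σ) where
  add_lie x y z := by ext <;> simp <;> ring
  lie_add x y z := by ext <;> simp <;> ring
  lie_self x := by ext <;> simp
  leibniz_lie x y z := by ext <;> simp; ring

variable {p : ℕ} [Algebra (ZMod p) F]

instance : Module (ZMod p) (TwistLie σ) where
  smul c x := ⟨c • x.a, c • x.r, c • x.b, c • x.s, c • x.z⟩
  one_smul x := by ext <;> exact one_smul _ _
  mul_smul c d x := by ext <;> exact mul_smul _ _ _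
  smul_zero c := by ext <;> exact smul_zero _
  smul_add c x y := by ext <;> exact smul_add _ _ _
  add_smul c d x := by ext <;> exact add_smul _ _ _
  zero_smul x := by ext <;> exact zero_smul _ _

@[simp] theorem smul_a (c : ZMod p) (x : TwistLie σ) : (c • x).a = c • x.a := rfl
@[simp] theorem smul_r (c : ZMod p) (x : TwistLie σ) : (c • x).r = c • x.r := rfl
@[simp] theorem smul_b (c : ZMod p) (x : TwistLie σ) : (c • x).b = c • x.b := rfl
@[simp] theorem smul_s (c : ZMod p) (x : TwistLie σ) : (c • x).s = c • x.s := rfl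
@[simp] theorem smul_z (c : ZMod p) (x : TwistLie σ) : (c • x).z = c • x.z := rfl

instance : LieAlgebra (ZMod p) (TwistLie σ) where
  lie_smul t x y := ZMod.map_smul (⟨⟨fun y => ⁅x, y⁆, lie_zero x⟩, lie_add x⟩ :
    TwistLie σ →+ TwistLie σ) t y

variable (p σ) in
/-- The coordinates of the Lie algebra. -/
def coords : TwistLie σ ≃ₗ[ZMod p] F × F × F × F × F where
  toFun x := (x.a, x.r, x.b, x.s, x.z)
  invFun x := ⟨x.1, x.2.1, x.2.2.1, x.2.2.2.1, x.2.2.2.2⟩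
  map_add' _ _ := rfl
  map_smul' _ _ := rfl

theorem finrank_eq (hF : Module.finrank (ZMod p) F = 3) [Fact p.Prime] :
    Module.finrank (ZMod p) (TwistLie σ) = 15 := by
  have : Module.Finite (ZMod p) F := Module.finite_of_finrank_pos (by omega)
  rw [(coords σ p).finrank_eq]
  simp [Module.finrank_prod, hF]

end Basic

/-! ### Derivations and their parameters -/

section Derivations

variable {F : Type*} [Field F] {σ : F →+* F} {p : ℕ} [Fact p.Prime] [Algebra (ZMod p) F]

/-- The degree one part generates: a derivation is determined by its values on the elements
`⟨a, r, 0, 0, 0⟩`. -/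
theorem derivation_ext [IsCubicTwist σ] (hF : Module.finrank (ZMod p) F = 3)
    {D E : LieDerivation (ZMod p) (TwistLie σ) (TwistLie σ)}
    (ha : ∀ a, D ⟨a, 0, 0, 0, 0⟩ = E ⟨a, 0, 0, 0, 0⟩)
    (hr : ∀ r, D ⟨0, r, 0, 0, 0⟩ = E ⟨0, r, 0, 0, 0⟩) : D = E := by
  have lie : ∀ x y, D x = E x → D y = E y → D ⁅x, y⁆ = E ⁅x, y⁆ := fun x y hx hy => by
    rw [LieDerivation.apply_lie_eq_add, LieDerivation.apply_lie_eq_add, hx, hy]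
  have hb : ∀ b, D ⟨0, 0, b, 0, 0⟩ = E ⟨0, 0, b, 0, 0⟩ := by
    have : (⊤ : AddSubgroup F) ≤ AddSubgroup.comap
        (⟨⟨fun b => ⟨0, 0, b, 0, 0⟩, rfl⟩, fun _ _ => by ext <;> simp⟩ : F →+ TwistLie σ)
        (((D : TwistLie σ →ₗ[ZMod p] TwistLie σ) - (E : TwistLie σ →ₗ[ZMod p] TwistLie σ)).ker
          |>.toAddSubgroup) := by
      rw [← addSubgroup_eq_top_of_twist_comm (σ := σ) hF]
      intro x y
      have := lie _ _ (ha x) (ha y)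
      simpa [Bracket.bracket, sub_eq_zero] using this
    intro b
    simpa [sub_eq_zero] using this (AddSubgroup.mem_top b)
  have hs : ∀ s, D ⟨0, 0, 0, s, 0⟩ = E ⟨0, 0, 0, s, 0⟩ := fun s => by
    have := lie _ _ (ha 1) (hr (σ (σ s)))
    simpa [Bracket.bracket] using this
  have hz : ∀ z, D ⟨0, 0, 0, 0, z⟩ = E ⟨0, 0, 0, 0, z⟩ := fun z => by
    have := lie _ _ (ha 1) (hs (σ (σ z)))
    simpa [Bracket.bracket] using this
  ext1 x
  have hx : x = ⟨x.a, 0, 0, 0, 0⟩ + ⟨0, x.r, 0, 0, 0⟩ + ⟨0, 0, x.b, 0, 0⟩ + ⟨0, 0, 0, x.s, 0⟩ +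
      ⟨0, 0, 0, 0, x.z⟩ := by ext <;> simp
  rw [hx]
  simp only [map_add, ha, hr, hb, hs, hz]

variable [IsCubicTwist σ]

variable (σ p) in
/-- The derivations that come from fifteen parameters in `F`. They are, in this order:
the scalars of `a ↦ a` and of `r ↦ r`; the coefficients of `1, σ` in `a ↦ b` and of `1, σ, σ²` in
`a ↦ s`; the coefficient of `1` in `r ↦ s` and of `σ²` in `r ↦ b`; the coefficients of `1, σ, σ²` in
`a ↦ z` and in `r ↦ z`. The other coefficients are determined by the Leibniz rule. -/
def der : (Fin 15 → F) →ₗ[ZMod p] LieDerivation (ZMod p) (TwistLie σ) (TwistLie σ) :=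
  AddMonoidHom.toZModLinearMap p
    { toFun := fun P =>
        { toLinearMap := AddMonoidHom.toZModLinearMap p
            { toFun := fun x =>
                ⟨P 0 * x.a, P 1 * x.r,
                  P 2 * x.a + P 3 * σ x.a + P 8 * σ (σ x.r) + (P 0 + σ (P 0)) * x.b,
                  P 4 * x.a + P 5 * σ x.a + P 6 * σ (σ x.a) + P 7 * x.r -
                    σ (σ (P 2)) * σ x.r + (P 0 + σ (P 1)) * x.s,
                  P 9 * x.a + P 10 * σ x.a + P 11 * σ (σ x.a) +
                    P 12 * x.r + P 13 * σ x.r + P 14 * σ (σ x.r) +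
                    σ (P 4) * x.b - σ (P 5) * σ (σ x.b) + σ (P 7) * x.s + P 3 * σ x.s +
                    (P 0 + σ (P 0) + σ (σ (P 1))) * x.z⟩
              map_zero' := by ext <;> simp
              map_add' := fun x y => by ext <;> simp <;> ring }
          leibniz' := fun x y => by ext <;> simp <;> ring }
      map_zero' := by ext x <;> simp
      map_add' := fun P Q => by ext x <;> simp <;> ring }

theorem der_apply (P : Fin 15 → F) (x : TwistLie σ) : der σ p P x =
    ⟨P 0 * x.a, P 1 * x.r,
      P 2 * x.a + P 3 * σ x.a + P 8 * σ (σ x.r) + (P 0 + σ (P 0)) * x.b,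
      P 4 * x.a + P 5 * σ x.a + P 6 * σ (σ x.a) + P 7 * x.r -
        σ (σ (P 2)) * σ x.r + (P 0 + σ (P 1)) * x.s,
      P 9 * x.a + P 10 * σ x.a + P 11 * σ (σ x.a) +
        P 12 * x.r + P 13 * σ x.r + P 14 * σ (σ x.r) +
        σ (P 4) * x.b - σ (P 5) * σ (σ x.b) + σ (P 7) * x.s + P 3 * σ x.s +
        (P 0 + σ (P 0) + σ (σ (P 1))) * x.z⟩ := rfl

end Derivations

section NormalForm

variable {F : Type*} [Field F] {σ : F →+* F}

variable (σ) in
/-- The inclusion of the coordinate `a`. -/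
def inA : F →+ TwistLie σ := ⟨⟨fun x => ⟨x, 0, 0, 0, 0⟩, rfl⟩, fun _ _ => by ext <;> simp⟩

variable (σ) in
/-- The inclusion of the coordinate `r`. -/
def inR : F →+ TwistLie σ := ⟨⟨fun x => ⟨0, x, 0, 0, 0⟩, rfl⟩, fun _ _ => by ext <;> simp⟩

variable (σ) in
/-- The inclusion of the coordinate `b`. -/
def inB : F →+ TwistLie σ := ⟨⟨fun x => ⟨0, 0, x, 0, 0⟩, rfl⟩, fun _ _ => by ext <;> simp⟩

variable (σ) in
/-- The inclusion of the coordinate `s`. -/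
def inS : F →+ TwistLie σ := ⟨⟨fun x => ⟨0, 0, 0, x, 0⟩, rfl⟩, fun _ _ => by ext <;> simp⟩

variable {p : ℕ} [Fact p.Prime] [Algebra (ZMod p) F] [IsCubicTwist σ]

/-- Every block of a derivation is of the form `k₀ + k₁ σ + k₂ σ²`. -/
theorem exists_block_coeffs (hF : Module.finrank (ZMod p) F = 3)
    (D : LieDerivation (ZMod p) (TwistLie σ) (TwistLie σ)) (i : F →+ TwistLie σ)
    (π : TwistLie σ → F) (hπ : ∀ x y, π (x + y) = π x + π y) :
    ∃ k₀ k₁ k₂ : F, ∀ x, π (D (i x)) = k₀ * x + k₁ * σ x + k₂ * σ (σ x) :=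
  exists_eq_twistPoly (σ := σ) hF
    (AddMonoidHom.mk' (fun x => π (D (i x))) fun x y => by rw [map_add, map_add, hπ])

/-- A derivation that maps no `a` to `r` belongs to the family `der`. Each identity below
compares the coefficients of the products `σⁱ x · σʲ y` in one coordinate of the Leibniz rule. -/
theorem exists_eq_der (hF : Module.finrank (ZMod p) F = 3)
    (D : LieDerivation (ZMod p) (TwistLie σ) (TwistLie σ)) (har : ∀ x, (D (inA σ x)).r = 0) :
    ∃ P, D = der σ p P := by
  have block := exists_block_coeffs hF D
  obtain ⟨aa₀, aa₁, aa₂, haa⟩ := block (inA σ) a fun _ _ => rfl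
  obtain ⟨ab₀, ab₁, ab₂, hab⟩ := block (inA σ) b fun _ _ => rfl
  obtain ⟨as₀, as₁, as₂, has⟩ := block (inA σ) s fun _ _ => rfl
  obtain ⟨az₀, az₁, az₂, haz⟩ := block (inA σ) z fun _ _ => rfl
  obtain ⟨ra₀, ra₁, ra₂, hra⟩ := block (inR σ) a fun _ _ => rfl
  obtain ⟨rr₀, rr₁, rr₂, hrr⟩ := block (inR σ) r fun _ _ => rfl
  obtain ⟨rb₀, rb₁, rb₂, hrb⟩ := block (inR σ) b fun _ _ => rfl
  obtain ⟨rs₀, rs₁, rs₂, hrs⟩ := block (inR σ) s fun _ _ => rfl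
  obtain ⟨rz₀, rz₁, rz₂, hrz⟩ := block (inR σ) z fun _ _ => rfl
  obtain ⟨sb₀, sb₁, sb₂, hsb⟩ := block (inS σ) b fun _ _ => rfl
  obtain ⟨ss₀, ss₁, ss₂, hss⟩ := block (inS σ) s fun _ _ => rfl
  obtain ⟨sz₀, sz₁, sz₂, hsz⟩ := block (inS σ) z fun _ _ => rfl
  have hRR : ∀ x y, ⁅inR σ x, D (inR σ y)⁆ - ⁅inR σ y, D (inR σ x)⁆ = 0 := fun x y => by
    rw [← LieDerivation.apply_lie_eq_sub, ← map_zero D]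
    congr 1
    ext <;> simp [inR]
  have hAR : ∀ x y, ⁅inA σ x, D (inR σ y)⁆ - ⁅inR σ y, D (inA σ x)⁆ - D (inS σ (x * σ y)) = 0 :=
    fun x y => by
      rw [← LieDerivation.apply_lie_eq_sub, ← map_sub, ← map_zero D]
      congr 1
      ext <;> simp [inR, inA, inS]
  obtain ⟨⟨-, hra₀, -⟩, -, ⟨-, hra₂, -⟩⟩ := twist_bilinear_coeff_eq_zero (σ := σ)
    (k₀₀ := 0) (k₀₁ := ra₀) (k₀₂ := 0) (k₁₀ := - ra₀) (k₁₁ := 0) (k₁₂ := -ra₂)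
    (k₂₀ := 0) (k₂₁ := ra₂) (k₂₂ := 0) fun x y => by
      have := congrArg s (hRR x y)
      simp only [sub_s, lie_s, hra] at this
      simp [inR] at this
      linear_combination this
  obtain ⟨⟨-, -, hra₁⟩, -, -⟩ := twist_bilinear_coeff_eq_zero (σ := σ)
    (k₀₀ := 0) (k₀₁ := - sb₀) (k₀₂ := σ ra₁) (k₁₀ := 0) (k₁₁ := - ra₁) (k₁₂ := -sb₁)
    (k₂₀ := - sb₂) (k₂₁ := 0) (k₂₂ := 0) fun x y => by
      have := congrArg b (hAR x y)
      simp only [sub_b, lie_b, hra, hsb, hra₀, hra₂] at this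
      simp [inR, inA] at this
      linear_combination this
  obtain ⟨⟨-, -, hrb₀⟩, ⟨-, -, hrb₁⟩, -⟩ := twist_bilinear_coeff_eq_zero (σ := σ)
    (k₀₀ := 0) (k₀₁ := 0) (k₀₂ := rb₀) (k₁₀ := 0) (k₁₁ := 0) (k₁₂ := rb₁)
    (k₂₀ := - rb₀) (k₂₁ := - rb₁) (k₂₂ := 0) fun x y => by
      have := congrArg z (hRR x y)
      simp only [sub_z, lie_z, hrb] at this
      simp [inR] at this
      linear_combination this
  obtain ⟨⟨hrr₂, -, hrr₁⟩, ⟨-, haa₁, -⟩, ⟨-, haa₂, -⟩⟩ := twist_bilinear_coeff_eq_zero (σ := σ)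
    (k₀₀ := σ rr₂) (k₀₁ := aa₀ + σ rr₀ - ss₀) (k₀₂ := σ rr₁) (k₁₀ := 0) (k₁₁ := aa₁) (k₁₂ := - ss₁)
    (k₂₀ := - ss₂) (k₂₁ := aa₂) (k₂₂ := 0) fun x y => by
      have := congrArg s (hAR x y)
      simp only [sub_s, lie_s, hrr, haa, har, hss] at this
      simp [inR, inA] at this
      linear_combination this
  obtain ⟨⟨hrs₂, -, hrs₁⟩, -, ⟨-, -, hab₂⟩⟩ := twist_bilinear_coeff_eq_zero (σ := σ)
    (k₀₀ := σ rs₂) (k₀₁ := σ rs₀ - sz₀) (k₀₂ := ab₀ + σ rs₁) (k₁₀ := 0) (k₁₁ := 0)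
    (k₁₂ := ab₁ - sz₁) (k₂₀ := - sz₂) (k₂₁ := 0) (k₂₂ := ab₂) fun x y => by
      have := congrArg z (hAR x y)
      simp only [sub_z, lie_z, hrs, hab, hsz] at this
      simp [inR, inA] at this
      linear_combination this
  have hrs₁' : rs₁ = - σ (σ ab₀) := by
    have := congrArg (fun x => σ (σ x)) hrs₁
    simp only [map_add, twist_cube, map_zero] at this
    linear_combination this
  rw [map_eq_zero] at hra₁ hrr₁ hrr₂ hrs₂
  refine ⟨![aa₀, rr₀, ab₀, ab₁, as₀, as₁, as₂, rs₀, rb₂, az₀, az₁, az₂, rz₀, rz₁, rz₂],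
    derivation_ext hF (fun x => ?_) fun x => ?_⟩
  · rw [der_apply]
    ext
    · exact (haa x).trans (by simp [haa₁, haa₂])
    · exact (har x).trans (by simp)
    · exact (hab x).trans (by simp [hab₂])
    · exact (has x).trans (by simp)
    · exact (haz x).trans (by simp)
  · rw [der_apply]
    ext
    · exact (hra x).trans (by simp [hra₀, hra₁, hra₂])
    · exact (hrr x).trans (by simp [hrr₁, hrr₂])
    · exact (hrb x).trans (by simp [hrb₀, hrb₁])
    · exact (hrs x).trans (by simp [hrs₁', hrs₂]; ring)
    · exact (hrz x).trans (by simp)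

/-- In odd characteristic no derivation maps `a` to `r`: the relation `[a, b] = 0` obstructs. -/
theorem derivation_inA_r (hF : Module.finrank (ZMod p) F = 3) (h2 : (2 : F) ≠ 0)
    (D : LieDerivation (ZMod p) (TwistLie σ) (TwistLie σ)) (x : F) : (D (inA σ x)).r = 0 := by
  have block := exists_block_coeffs hF D
  obtain ⟨ar₀, ar₁, ar₂, har⟩ := block (inA σ) r fun _ _ => rfl
  obtain ⟨bs₀, bs₁, bs₂, hbs⟩ := block (inB σ) s fun _ _ => rfl
  have hAA : ∀ x y, ⁅inA σ x, D (inA σ y)⁆ - ⁅inA σ y, D (inA σ x)⁆ -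
      D (inB σ (x * σ y - y * σ x)) = 0 := fun x y => by
    rw [← LieDerivation.apply_lie_eq_sub, ← map_sub, ← map_zero D]
    congr 1
    ext <;> simp [inA, inB]
  have hAB : ∀ x y, ⁅inA σ x, D (inB σ y)⁆ - ⁅inB σ y, D (inA σ x)⁆ = 0 := fun x y => by
    rw [← LieDerivation.apply_lie_eq_sub, ← map_zero D]
    congr 1
    ext <;> simp [inA, inB]
  obtain ⟨⟨-, h₀, h₁⟩, ⟨-, -, h₂⟩, -⟩ := twist_bilinear_coeff_eq_zero (σ := σ)
    (k₀₀ := 0) (k₀₁ := σ ar₀ - bs₀) (k₀₂ := σ ar₁ + bs₂) (k₁₀ := bs₀ - σ ar₀) (k₁₁ := 0)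
    (k₁₂ := - bs₁) (k₂₀ := - bs₂ - σ ar₁) (k₂₁ := bs₁) (k₂₂ := 0) fun x y => by
      have := congrArg s (hAA x y)
      simp only [sub_s, lie_s, har, hbs] at this
      simp [inA] at this
      linear_combination this
  obtain ⟨⟨h₃, h₄, h₅⟩, ⟨h₆, -, -⟩, ⟨h₇, -, -⟩⟩ := twist_bilinear_coeff_eq_zero (σ := σ)
    (k₀₀ := σ bs₂ - σ (σ ar₁)) (k₀₁ := σ bs₀) (k₀₂ := σ bs₁)
    (k₁₀ := - σ (σ ar₂)) (k₁₁ := 0) (k₁₂ := 0)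
    (k₂₀ := - σ (σ ar₀)) (k₂₁ := 0) (k₂₂ := 0) fun x y => by
      have := congrArg z (hAB x y)
      simp only [sub_z, lie_z, har, hbs] at this
      simp [inA, inB] at this
      linear_combination this
  have h₈ : (2 : F) * σ (σ ar₁) = 0 := by
    have := congrArg σ h₁
    simp only [map_add, map_zero] at this
    linear_combination this - h₃
  have h₉ := (mul_eq_zero.1 h₈).resolve_left h2
  rw [neg_eq_zero] at h₆ h₇
  rw [map_eq_zero, map_eq_zero] at h₆ h₇ h₉
  rw [har, h₆, h₇, h₉]
  simp

theorem der_injective : Function.Injective (der σ p) := by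
  rw [injective_iff_map_eq_zero]
  intro P hP
  have hA := fun x => LieDerivation.congr_fun hP (inA σ x)
  have hR := fun x => LieDerivation.congr_fun hP (inR σ x)
  simp only [der_apply, inA, inR, AddMonoidHom.coe_mk, ZeroHom.coe_mk, LieDerivation.zero_apply,
    TwistLie.ext_iff, zero_a, zero_r, zero_b, zero_s, zero_z, mul_zero, map_zero, add_zero,
    zero_add, sub_zero] at hA hR
  have h0 : P 0 = 0 := by simpa using (hA 1).1
  have h1 : P 1 = 0 := by simpa using (hR 1).2.1
  have h8 : P 8 = 0 := by simpa using (hR 1).2.2.1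
  obtain ⟨h2, h3, -⟩ := twist_linear_coeff_eq_zero (σ := σ) (k₀ := P 2) (k₁ := P 3) (k₂ := 0)
    fun x => by simpa using (hA x).2.2.1
  obtain ⟨h4, h5, h6⟩ := twist_linear_coeff_eq_zero (σ := σ) fun x => (hA x).2.2.2.1
  have h7 : P 7 = 0 := by simpa [h2] using (hR 1).2.2.2.1
  obtain ⟨h9, h10, h11⟩ := twist_linear_coeff_eq_zero (σ := σ) fun x => (hA x).2.2.2.2
  obtain ⟨h12, h13, h14⟩ := twist_linear_coeff_eq_zero (σ := σ) fun x => (hR x).2.2.2.2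
  funext i
  fin_cases i <;> assumption

theorem finrank_derivations (hF : Module.finrank (ZMod p) F = 3) (h2 : (2 : F) ≠ 0) :
    Module.finrank (ZMod p) (LieDerivation (ZMod p) (TwistLie σ) (TwistLie σ)) = 45 := by
  have : Module.Finite (ZMod p) F := Module.finite_of_finrank_pos (by omega)
  rw [← (LinearEquiv.ofBijective (der σ p) ⟨der_injective, fun D =>
    (exists_eq_der hF D (derivation_inA_r hF h2 D)).imp fun _ => Eq.symm⟩).finrank_eq]
  simp [Module.finrank_pi_fintype, hF]

end NormalForm

/-! ### Almost-inner derivations of the graded Lie algebra -/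

section AlmostInner

variable {F : Type*} [Field F] {σ : F →+* F} {p : ℕ} [Fact p.Prime] [Algebra (ZMod p) F]

variable (σ p) in
/-- The parameters of the almost-inner derivations. In the order of `Q` they are: the element `f`
for which `a ↦ b` is the map `x ↦ f σ(x) - x σ(f)`; the coefficient of `1` in `r ↦ s`; the
coefficients of `1, σ, σ²` in `a ↦ s`, in `a ↦ z` and in `r ↦ z`. -/
def aidParam : (Fin 11 → F) →ₗ[ZMod p] (Fin 15 → F) :=
  AddMonoidHom.toZModLinearMap p
    { toFun := fun Q =>
        ![0, 0, - σ (Q 0), Q 0, Q 2, Q 3, Q 4, Q 1, 0, Q 5, Q 6, Q 7, Q 8, Q 9, Q 10]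
      map_zero' := by funext i; fin_cases i <;> simp
      map_add' := fun P Q => by
        funext i
        fin_cases i <;> simp; ring }

theorem aidParam_apply (Q : Fin 11 → F) : aidParam σ p Q =
    ![0, 0, - σ (Q 0), Q 0, Q 2, Q 3, Q 4, Q 1, 0, Q 5, Q 6, Q 7, Q 8, Q 9, Q 10] := rfl

theorem aidParam_injective : Function.Injective (aidParam σ p) := by
  intro P Q h
  rw [aidParam_apply, aidParam_apply] at h
  funext i
  fin_cases i
  exacts [congrFun h 3, congrFun h 7, congrFun h 4, congrFun h 5, congrFun h 6, congrFun h 9,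
    congrFun h 10, congrFun h 11, congrFun h 12, congrFun h 13, congrFun h 14]

variable (σ p) in
/-- The parameters of the inner derivation of `⟨a, r, b, s, 0⟩`, as almost-inner parameters. -/
def innParam : (Fin 4 → F) →ₗ[ZMod p] (Fin 11 → F) :=
  AddMonoidHom.toZModLinearMap p
    { toFun := fun x => ![x 0, 0, - σ (x 1), 0, 0, - σ (x 3), 0, 0, 0, 0, x 2]
      map_zero' := by funext i; fin_cases i <;> simp
      map_add' := fun P Q => by
        funext i
        fin_cases i <;> simp <;> ring }

theorem innParam_apply (x : Fin 4 → F) :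
    innParam σ p x = ![x 0, 0, - σ (x 1), 0, 0, - σ (x 3), 0, 0, 0, 0, x 2] := rfl

theorem innParam_injective : Function.Injective (innParam σ p) := by
  intro x y h
  rw [innParam_apply, innParam_apply] at h
  funext i
  fin_cases i
  exacts [congrFun h 0, σ.injective (neg_injective (congrFun h 2)), congrFun h 10,
    σ.injective (neg_injective (congrFun h 5))]

variable [IsCubicTwist σ]

variable (σ p) in
/-- The almost-inner derivation with the given parameters. -/
def aidDer : (Fin 11 → F) →ₗ[ZMod p] LieDerivation (ZMod p) (TwistLie σ) (TwistLie σ) :=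
  der σ p ∘ₗ aidParam σ p

theorem aidDer_apply (Q : Fin 11 → F) (x : TwistLie σ) : aidDer σ p Q x =
    ⟨0, 0, Q 0 * σ x.a - x.a * σ (Q 0),
      Q 2 * x.a + Q 3 * σ x.a + Q 4 * σ (σ x.a) + Q 1 * x.r + Q 0 * σ x.r,
      Q 5 * x.a + Q 6 * σ x.a + Q 7 * σ (σ x.a) +
        Q 8 * x.r + Q 9 * σ x.r + Q 10 * σ (σ x.r) +
        σ (Q 2) * x.b - σ (Q 3) * σ (σ x.b) + σ (Q 1) * x.s + Q 0 * σ x.s⟩ := by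
  rw [aidDer, LinearMap.comp_apply, der_apply, aidParam_apply]
  ext <;> simp
  ring

theorem aidDer_injective : Function.Injective (aidDer σ p) :=
  der_injective.comp aidParam_injective

theorem ad_eq_aidDer (x : TwistLie σ) :
    LieDerivation.ad (ZMod p) (TwistLie σ) x =
      aidDer σ p (innParam σ p ![x.a, x.r, x.b, x.s]) := by
  ext1 y
  rw [LieDerivation.ad_apply_apply, aidDer_apply, innParam_apply]
  ext <;> simp <;> ring

theorem innDer_eq_range :
    (InnDer (ZMod p) (TwistLie σ)).toSubmodule = (aidDer σ p ∘ₗ innParam σ p).range := by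
  ext D
  constructor
  · rintro ⟨x, rfl⟩
    exact ⟨_, (ad_eq_aidDer x).symm⟩
  · rintro ⟨x, rfl⟩
    refine ⟨⟨x 0, x 1, x 2, x 3, 0⟩, (ad_eq_aidDer _).trans ?_⟩
    rw [LinearMap.comp_apply]
    congr 2

/-- Every `aidDer` is almost inner. On an element with `a ≠ 0` the degree two part of its image is
that of the bracket with `⟨f, r, …⟩` for a suitable `r`, and the bracket with the coordinate `s`
reaches every `z`; on the remaining elements one coordinate of the image is to be reached after
another. -/
theorem aidDer_mem_AID (Q : Fin 11 → F) : aidDer σ p Q ∈ AID (ZMod p) (TwistLie σ) := by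
  intro y
  rw [aidDer_apply]
  rcases eq_or_ne y.a 0 with ha | ha
  · rcases eq_or_ne y.r 0 with hr | hr
    · rcases eq_or_ne y.s 0 with hs | hs
      · rcases eq_or_ne y.b 0 with hb | hb
        · exact ⟨0, by ext <;> simp [ha, hr, hs, hb]⟩
        · refine ⟨⟨0, - σ ((σ (Q 2) * y.b - σ (Q 3) * σ (σ y.b)) / y.b), 0, 0, 0⟩, ?_⟩
          ext <;> simp [ha, hr, hs, -map_mul, -map_sub, -map_div₀]
          field_simp
      · refine ⟨⟨(σ (Q 2) * y.b - σ (Q 3) * σ (σ y.b) + σ (Q 1) * y.s + Q 0 * σ y.s) / σ y.s,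
          0, 0, 0, 0⟩, ?_⟩
        have : σ y.s ≠ 0 := by simpa
        ext <;> simp [ha, hr]
        field_simp
    · have h₁ : σ y.r ≠ 0 := by simpa
      have h₂ : σ (σ y.r) ≠ 0 := by simpa
      refine ⟨⟨(Q 1 * y.r + Q 0 * σ y.r) / σ y.r, 0, (Q 8 * y.r + Q 9 * σ y.r + Q 10 * σ (σ y.r) +
        σ (Q 2) * y.b - σ (Q 3) * σ (σ y.b) + σ (Q 1) * y.s + Q 0 * σ y.s -
          (Q 1 * y.r + Q 0 * σ y.r) / σ y.r * σ y.s) / σ (σ y.r), 0, 0⟩, ?_⟩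
      ext <;> simp [ha]
      · field_simp
      · field_simp
        ring
  · generalize hz : Q 5 * y.a + Q 6 * σ y.a + Q 7 * σ (σ y.a) +
        Q 8 * y.r + Q 9 * σ y.r + Q 10 * σ (σ y.r) +
        σ (Q 2) * y.b - σ (Q 3) * σ (σ y.b) + σ (Q 1) * y.s + Q 0 * σ y.s = z
    generalize hs : Q 2 * y.a + Q 3 * σ y.a + Q 4 * σ (σ y.a) + Q 1 * y.r + Q 0 * σ y.r = s
    obtain ⟨r, hr⟩ : ∃ r, σ r = (Q 0 * σ y.r - s) / y.a := ⟨σ (σ _), twist_cube _⟩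
    obtain ⟨t, ht⟩ : ∃ t, σ t = (Q 0 * σ y.s - y.b * σ (σ r) - z) / y.a := ⟨σ (σ _), twist_cube _⟩
    refine ⟨⟨Q 0, r, 0, t, 0⟩, ?_⟩
    ext <;> simp only [lie_a, lie_r, lie_b, lie_s, lie_z, hr, ht]
    · field_simp
      ring
    · rw [← hr]
      field_simp
      ring

/-- An almost-inner derivation is an `aidDer`. Besides the vanishing of the parameters that do not
map into `[L, x]`, the condition on `a ↦ b` is that `k₀ / σ(x) + k₁ / x` is of the form `c - σ(c)`,
hence of trace zero, for every `x ≠ 0`. -/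
theorem exists_eq_aidDer (hF : Module.finrank (ZMod p) F = 3)
    {D : LieDerivation (ZMod p) (TwistLie σ) (TwistLie σ)} (hD : D ∈ AID (ZMod p) (TwistLie σ)) :
    ∃ Q, D = aidDer σ p Q := by
  obtain ⟨P, rfl⟩ := exists_eq_der hF D fun x => by
    obtain ⟨y, hy⟩ := hD (inA σ x)
    rw [hy, lie_r]
  have hA : ∀ x, ∃ y : TwistLie σ, der σ p P (inA σ x) = ⁅y, inA σ x⁆ := fun x => hD (inA σ x)
  obtain ⟨y, hy⟩ := hA 1
  obtain ⟨y', hy'⟩ := hD (inR σ 1)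
  simp only [der_apply, inA, inR, AddMonoidHom.coe_mk, ZeroHom.coe_mk, TwistLie.ext_iff]
    at hy hy' hA
  have h0 : P 0 = 0 := by simpa using hy.1
  have h1 : P 1 = 0 := by simpa using hy'.2.1
  have h8 : P 8 = 0 := by simpa using hy'.2.2.1
  have h2 : P 2 = - σ (P 3) := by
    obtain ⟨h, -, -⟩ := twist_linear_coeff_eq_zero (σ := σ) (k₀ := P 3 + σ (σ (P 2)))
      (k₁ := P 2 + σ (P 3)) (k₂ := σ (P 2) + σ (σ (P 3))) fun x => by
        rcases eq_or_ne x 0 with rfl | hx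
        · simp
        obtain ⟨y, -, -, hb, -⟩ := hA x⁻¹
        simp only [lie_b, map_inv₀, mul_zero, map_zero, add_zero] at hb
        have h₁ : σ x ≠ 0 := by simpa
        have h₂ : P 2 * σ x + P 3 * x = x * y.a - σ (x * y.a) := by
          rw [map_mul]
          field_simp at hb
          linear_combination hb
        have h₃ := congrArg σ h₂
        have h₄ := congrArg σ h₃
        simp only [map_add, map_sub, map_mul, twist_cube] at h₂ h₃ h₄
        linear_combination h₂ + h₃ + h₄
    have := congrArg σ h
    simp only [map_add, twist_cube, map_zero] at this
    linear_combination this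
  refine ⟨![P 3, P 7, P 4, P 5, P 6, P 9, P 10, P 11, P 12, P 13, P 14], ?_⟩
  rw [aidDer, LinearMap.comp_apply]
  congr 1
  funext i
  fin_cases i
  exacts [h0, h1, h2, rfl, rfl, rfl, rfl, rfl, h8, rfl, rfl, rfl, rfl, rfl, rfl]

theorem AID_eq_range (hF : Module.finrank (ZMod p) F = 3) :
    (AID (ZMod p) (TwistLie σ)).toSubmodule = (aidDer σ p).range := by
  ext D
  constructor
  · intro hD
    obtain ⟨Q, rfl⟩ := exists_eq_aidDer hF hD
    exact ⟨Q, rfl⟩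
  · rintro ⟨Q, rfl⟩
    exact aidDer_mem_AID Q

theorem finrank_AID (hF : Module.finrank (ZMod p) F = 3) :
    Module.finrank (ZMod p) (AID (ZMod p) (TwistLie σ)) = 33 := by
  have : Module.Finite (ZMod p) F := Module.finite_of_finrank_pos (by omega)
  change Module.finrank (ZMod p) (AID (ZMod p) (TwistLie σ)).toSubmodule = 33
  rw [AID_eq_range hF, LinearMap.finrank_range_of_inj aidDer_injective]
  simp [Module.finrank_pi_fintype, hF]

theorem finrank_innDer (hF : Module.finrank (ZMod p) F = 3) :
    Module.finrank (ZMod p) (InnDer (ZMod p) (TwistLie σ)) = 12 := by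
  have : Module.Finite (ZMod p) F := Module.finite_of_finrank_pos (by omega)
  change Module.finrank (ZMod p) (InnDer (ZMod p) (TwistLie σ)).toSubmodule = 12
  rw [innDer_eq_range, LinearMap.finrank_range_of_inj
    (by rw [LinearMap.coe_comp]; exact aidDer_injective.comp innParam_injective)]
  simp [Module.finrank_pi_fintype, hF]

/-- The bracket of two almost-inner derivations has degree two. -/
theorem lie_aidDer (hF : Module.finrank (ZMod p) F = 3) (P Q : Fin 11 → F) :
    ⁅aidDer σ p P, aidDer σ p Q⁆ = aidDer σ p ![0, 0, 0, 0, 0,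
      (σ (P 1) * Q 2 + P 0 * σ (Q 4) - σ (P 2) * σ (Q 0) - σ (P 3) * σ (σ (Q 0))) -
        (σ (Q 1) * P 2 + Q 0 * σ (P 4) - σ (Q 2) * σ (P 0) - σ (Q 3) * σ (σ (P 0))),
      σ (P 1) * Q 3 - σ (Q 1) * P 3, σ (P 1) * Q 4 - σ (Q 1) * P 4,
      σ (P 1) * Q 1 - σ (Q 1) * P 1, 0, P 0 * σ (Q 0) - Q 0 * σ (P 0)] := by
  refine derivation_ext hF (fun x => ?_) fun x => ?_ <;>
  · rw [LieDerivation.lie_apply]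
    simp only [aidDer_apply]
    ext <;> simp
    ring

/-- Two almost-inner derivations with a non-inner bracket. -/
theorem lie_aidDer_notMem_innDer (hF : Module.finrank (ZMod p) F = 3) {P Q : Fin 11 → F}
    (h : σ (P 1) * Q 3 ≠ σ (Q 1) * P 3) :
    ⁅aidDer σ p P, aidDer σ p Q⁆ ∉ InnDer (ZMod p) (TwistLie σ) := by
  rw [lie_aidDer hF, ← LieSubalgebra.mem_toSubmodule, innDer_eq_range]
  rintro ⟨x, hx⟩
  have := congrFun (aidDer_injective hx) 6
  exact h (sub_eq_zero.1 this.symm)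

end AlmostInner

/-! ### A complement of the inner derivations -/

section Complement

variable {F : Type*} [Field F] {σ : F →+* F} {p : ℕ} [Fact p.Prime] [Algebra (ZMod p) F]

theorem twistTrace_add (x y : F) : twistTrace σ (x + y) = twistTrace σ x + twistTrace σ y := by
  simp only [twistTrace, map_add]
  ring

variable (σ p) in
/-- The parameters of the complement of the inner derivations. The almost-inner derivation with
these parameters maps `⟨1, 0, 0, 0, 0⟩` to `0`, and maps `r` to `z` without a `σ²`-term; the
relation `f = Tr(t)` excludes `ad ⟨1, 0, 0, 0, 0⟩`. -/
def complParam : (Fin 7 → F) →ₗ[ZMod p] (Fin 11 → F) :=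
  AddMonoidHom.toZModLinearMap p
    { toFun := fun R => ![twistTrace σ (R 0), R 0, - R 1 - R 2, R 1, R 2, - R 3 - R 4, R 3, R 4,
        R 5, R 6, 0]
      map_zero' := by funext i; fin_cases i <;> simp [twistTrace]
      map_add' := fun P Q => by
        funext i
        fin_cases i <;> simp [twistTrace_add] <;> ring }

theorem complParam_apply (R : Fin 7 → F) : complParam σ p R =
    ![twistTrace σ (R 0), R 0, - R 1 - R 2, R 1, R 2, - R 3 - R 4, R 3, R 4, R 5, R 6, 0] := rfl

theorem complParam_injective : Function.Injective (complParam σ p) := by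
  intro P Q h
  rw [complParam_apply, complParam_apply] at h
  funext i
  fin_cases i
  exacts [congrFun h 1, congrFun h 3, congrFun h 4, congrFun h 6, congrFun h 7, congrFun h 8,
    congrFun h 9]

variable [IsCubicTwist σ]

theorem twist_twistTrace (x : F) : σ (twistTrace σ x) = twistTrace σ x := by
  simp only [twistTrace, map_add, twist_cube]
  ring

/-- A subalgebra of almost-inner derivations that is a complement of the inner ones. -/
def compl (hF : Module.finrank (ZMod p) F = 3) :
    LieSubalgebra (ZMod p) (LieDerivation (ZMod p) (TwistLie σ) (TwistLie σ)) where
  __ := (aidDer σ p ∘ₗ complParam σ p).range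
  lie_mem' := by
    rintro _ _ ⟨P, rfl⟩ ⟨Q, rfl⟩
    refine ⟨![0, 0, 0, σ (P 0) * Q 1 - σ (Q 0) * P 1, σ (P 0) * Q 2 - σ (Q 0) * P 2,
      σ (P 0) * Q 0 - σ (Q 0) * P 0, 0], ?_⟩
    rw [LinearMap.comp_apply, LinearMap.comp_apply, LinearMap.comp_apply, lie_aidDer hF]
    congr 1
    simp only [complParam_apply]
    funext i
    fin_cases i <;> simp [twist_twistTrace]
    · simp [twistTrace]
    all_goals ring

theorem compl_toSubmodule (hF : Module.finrank (ZMod p) F = 3) :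
    (compl (σ := σ) hF).toSubmodule = (aidDer σ p ∘ₗ complParam σ p).range := rfl

theorem finrank_compl (hF : Module.finrank (ZMod p) F = 3) :
    Module.finrank (ZMod p) (compl (σ := σ) hF) = 21 := by
  have : Module.Finite (ZMod p) F := Module.finite_of_finrank_pos (by omega)
  change Module.finrank (ZMod p) (aidDer σ p ∘ₗ complParam σ p).range = 21
  rw [LinearMap.finrank_range_of_inj
    (by rw [LinearMap.coe_comp]; exact aidDer_injective.comp complParam_injective)]
  simp [Module.finrank_pi_fintype, hF]

theorem disjoint_innDer_compl (hF : Module.finrank (ZMod p) F = 3) :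
    Disjoint (InnDer (ZMod p) (TwistLie σ)).toSubmodule (compl (σ := σ) hF).toSubmodule := by
  rw [innDer_eq_range, compl_toSubmodule, Submodule.disjoint_def]
  rintro _ ⟨x, rfl⟩ ⟨R, hR⟩
  have h : complParam σ p R = innParam σ p x := aidDer_injective hR
  rw [complParam_apply, innParam_apply] at h
  have h1 : R 0 = 0 := congrFun h 1
  have h3 : R 1 = 0 := congrFun h 3
  have h4 : R 2 = 0 := congrFun h 4
  have h6 : R 3 = 0 := congrFun h 6
  have h7 : R 4 = 0 := congrFun h 7
  have h8 : R 5 = 0 := congrFun h 8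
  have h9 : R 6 = 0 := congrFun h 9
  have hR : R = 0 := by
    funext i
    fin_cases i <;> assumption
  rw [LinearMap.comp_apply, show innParam σ p x = (0 : Fin 11 → F) from by
    rw [innParam_apply, ← h, ← complParam_apply (p := p), hR, map_zero], map_zero]

theorem innDer_sup_compl (hF : Module.finrank (ZMod p) F = 3) :
    (InnDer (ZMod p) (TwistLie σ)).toSubmodule ⊔ (compl (σ := σ) hF).toSubmodule =
      (AID (ZMod p) (TwistLie σ)).toSubmodule := by
  have : Module.Finite (ZMod p) F := Module.finite_of_finrank_pos (by omega)
  have : Module.Finite (ZMod p) (AID (ZMod p) (TwistLie σ)).toSubmodule := by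
    rw [AID_eq_range hF]; infer_instance
  have : Module.Finite (ZMod p) (InnDer (ZMod p) (TwistLie σ)).toSubmodule := by
    rw [innDer_eq_range]; infer_instance
  have : Module.Finite (ZMod p) (compl (σ := σ) hF).toSubmodule := by
    rw [compl_toSubmodule]; infer_instance
  refine Submodule.eq_of_le_of_finrank_eq (sup_le ?_ ?_) ?_
  · rw [innDer_eq_range, AID_eq_range hF]
    exact LinearMap.range_comp_le_range _ _
  · rw [compl_toSubmodule, AID_eq_range hF]
    exact LinearMap.range_comp_le_range _ _
  · have h := Submodule.finrank_sup_add_finrank_inf_eq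
      (InnDer (ZMod p) (TwistLie σ)).toSubmodule (compl (σ := σ) hF).toSubmodule
    rw [(disjoint_innDer_compl hF).eq_bot, finrank_bot, add_zero] at h
    exact h.trans ((congrArg₂ (· + ·) (finrank_innDer hF) (finrank_compl hF)).trans
      (finrank_AID hF).symm)

end Complement

end TwistLie

/-! ### Transport of derivations along an isomorphism -/

section Transport

variable {R L L' : Type*} [CommRing R] [LieRing L] [LieAlgebra R L] [LieRing L'] [LieAlgebra R L']

/-- Conjugation of derivations by an isomorphism of Lie algebras. -/
def LieEquiv.derivationCongr (e : L ≃ₗ⁅R⁆ L') :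
    LieDerivation R L L ≃ₗ⁅R⁆ LieDerivation R L' L' where
  toFun D :=
    { toLinearMap := e.toLinearEquiv.toLinearMap ∘ₗ
        (D : L →ₗ[R] L) ∘ₗ e.symm.toLinearEquiv.toLinearMap
      leibniz' := fun x y => by
        change e (D (e.symm ⁅x, y⁆)) = ⁅x, e (D (e.symm y))⁆ - ⁅y, e (D (e.symm x))⁆
        rw [e.symm.map_lie, D.apply_lie_eq_sub, map_sub, e.map_lie, e.map_lie,
          e.apply_symm_apply, e.apply_symm_apply] }
  invFun D :=
    { toLinearMap := e.symm.toLinearEquiv.toLinearMap ∘ₗ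
        (D : L' →ₗ[R] L') ∘ₗ e.toLinearEquiv.toLinearMap
      leibniz' := fun x y => by
        change e.symm (D (e ⁅x, y⁆)) = ⁅x, e.symm (D (e y))⁆ - ⁅y, e.symm (D (e x))⁆
        rw [e.map_lie, D.apply_lie_eq_sub, map_sub, e.symm.map_lie, e.symm.map_lie,
          e.symm_apply_apply, e.symm_apply_apply] }
  map_add' D E := by ext; simp
  map_smul' c D := by ext; simp
  map_lie' {D E} := by
    ext x
    rw [LieDerivation.lie_apply]
    change e (⁅D, E⁆ (e.symm x)) = e (D (e.symm (e (E (e.symm x))))) -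
      e (E (e.symm (e (D (e.symm x)))))
    rw [LieDerivation.lie_apply, map_sub, e.symm_apply_apply, e.symm_apply_apply]
  left_inv D := by ext; simp
  right_inv D := by ext; simp

variable (e : L ≃ₗ⁅R⁆ L')

theorem LieEquiv.derivationCongr_apply (D : LieDerivation R L L) (x : L') :
    e.derivationCongr D x = e (D (e.symm x)) := rfl

theorem LieEquiv.derivationCongr_mem_AID {D : LieDerivation R L L} :
    e.derivationCongr D ∈ AID R L' ↔ D ∈ AID R L := by
  constructor
  · intro h x
    obtain ⟨y, hy⟩ := h (e x)
    refine ⟨e.symm y, e.injective ?_⟩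
    rw [LieEquiv.derivationCongr_apply, e.symm_apply_apply] at hy
    change e (D x) = e ⁅e.symm y, x⁆
    rw [hy, e.map_lie, e.apply_symm_apply]
  · intro h x
    obtain ⟨y, hy⟩ := h (e.symm x)
    exact ⟨e y, by rw [LieEquiv.derivationCongr_apply, hy, e.map_lie, e.apply_symm_apply]⟩

theorem LieEquiv.derivationCongr_mem_innDer {D : LieDerivation R L L} :
    e.derivationCongr D ∈ InnDer R L' ↔ D ∈ InnDer R L := by
  constructor
  · rintro ⟨y, hy⟩
    refine ⟨e.symm y, e.derivationCongr.injective (hy ▸ ?_)⟩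
    ext x
    change e (LieDerivation.ad R L (e.symm y) (e.symm x)) = LieDerivation.ad R L' y x
    rw [LieDerivation.ad_apply_apply, LieDerivation.ad_apply_apply, e.map_lie,
      e.apply_symm_apply, e.apply_symm_apply]
  · rintro ⟨y, rfl⟩
    refine ⟨e y, ?_⟩
    ext x
    change LieDerivation.ad R L' (e y) x = e (LieDerivation.ad R L y (e.symm x))
    rw [LieDerivation.ad_apply_apply, LieDerivation.ad_apply_apply, e.map_lie, e.apply_symm_apply]

theorem LieEquiv.map_AID : (AID R L).toSubmodule.map
    (e.derivationCongr.toLinearEquiv : LieDerivation R L L →ₗ[R] _) = (AID R L').toSubmodule := by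
  ext D
  constructor
  · rintro ⟨E, hE, rfl⟩
    exact e.derivationCongr_mem_AID.2 hE
  · intro hD
    obtain ⟨E, rfl⟩ := e.derivationCongr.surjective D
    exact ⟨E, e.derivationCongr_mem_AID.1 hD, rfl⟩

theorem LieEquiv.map_innDer : (InnDer R L).toSubmodule.map
    (e.derivationCongr.toLinearEquiv : LieDerivation R L L →ₗ[R] _) =
      (InnDer R L').toSubmodule := by
  ext D
  constructor
  · rintro ⟨E, hE, rfl⟩
    exact e.derivationCongr_mem_innDer.2 hE
  · intro hD
    obtain ⟨E, rfl⟩ := e.derivationCongr.surjective D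
    exact ⟨E, e.derivationCongr_mem_innDer.1 hD, rfl⟩

theorem not_isLieAbelian_sha {D E : LieDerivation R L L} (hD : D ∈ AID R L) (hE : E ∈ AID R L)
    (h : ⁅D, E⁆ ∉ InnDer R L) : ¬ IsLieAbelian (Sha R L) := by
  intro hab
  have h' := hab.trivial (LieSubmodule.Quotient.mk (N := innIdeal R L) ⟨D, hD⟩)
    (LieSubmodule.Quotient.mk (N := innIdeal R L) ⟨E, hE⟩)
  rw [← LieSubmodule.Quotient.mk_bracket, LieSubmodule.Quotient.mk_eq_zero'] at h'
  exact h h'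

end Transport

/-! ### The Lie algebra of the split extension -/

namespace SplitExt

open scoped commutatorElement

section Coordinates

variable {F : Type*} [Field F] {σ : F →+* F}

/-- The coordinates of an element of the split extension, as a vector of the Lie algebra. -/
def crd (g : SplitExt F σ) : TwistLie σ :=
  ⟨((g.right : (TwistedRing F σ)ˣ) : TwistedRing F σ).c₁, (Multiplicative.toAdd g.left).c₀,
    ((g.right : (TwistedRing F σ)ˣ) : TwistedRing F σ).c₂, (Multiplicative.toAdd g.left).c₁,
    (Multiplicative.toAdd g.left).c₂⟩

theorem right_c₀ (g : SplitExt F σ) :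
    ((g.right : (TwistedRing F σ)ˣ) : TwistedRing F σ).c₀ = 1 := g.right.2

theorem crd_mul (g h : SplitExt F σ) : crd (g * h) = crd g + crd h +
    ⟨0, 0, (crd g).a * σ (crd h).a, (crd g).a * σ (crd h).r,
      (crd g).a * σ (crd h).s + (crd g).b * σ (σ (crd h).r)⟩ := by
  have hl : Multiplicative.toAdd (g * h).left = Multiplicative.toAdd g.left +
      ((g.right : (TwistedRing F σ)ˣ) : TwistedRing F σ) * Multiplicative.toAdd h.left := rfl
  have hr : (((g * h).right : (TwistedRing F σ)ˣ) : TwistedRing F σ) =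
      ((g.right : (TwistedRing F σ)ˣ) : TwistedRing F σ) *
        ((h.right : (TwistedRing F σ)ˣ) : TwistedRing F σ) := rfl
  unfold crd
  rw [hl, hr]
  ext <;> simp [right_c₀] <;> ring

theorem crd_one : crd (1 : SplitExt F σ) = 0 := rfl

theorem crd_injective : Function.Injective (crd : SplitExt F σ → TwistLie σ) := by
  intro g h hgh
  refine SemidirectProduct.ext ?_ ?_
  · refine Multiplicative.toAdd.injective (TwistedRing.ext ?_ ?_ ?_)
    exacts [congrArg TwistLie.r hgh, congrArg TwistLie.s hgh, congrArg TwistLie.z hgh]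
  · refine Subtype.ext (Units.ext (TwistedRing.ext ?_ ?_ ?_))
    exacts [(right_c₀ g).trans (right_c₀ h).symm, congrArg TwistLie.a hgh,
      congrArg TwistLie.b hgh]

theorem crd_surjective : Function.Surjective (crd : SplitExt F σ → TwistLie σ) := by
  intro x
  let u : (TwistedRing F σ)ˣ := ⟨⟨1, x.a, x.b⟩, ⟨1, - x.a, x.a * σ x.a - x.b⟩,
    by ext <;> simp; ring, by ext <;> simp; ring⟩
  exact ⟨⟨Multiplicative.ofAdd ⟨x.r, x.s, x.z⟩, ⟨u, rfl⟩⟩, rfl⟩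

end Coordinates

section Filtration

variable {F : Type*} [Field F] {σ : F →+* F}

variable (σ) in
/-- The projection of the Lie algebra onto its part of degree `n + 1`. -/
def gr (n : ℕ) : TwistLie σ →+ TwistLie σ :=
  AddMonoidHom.mk' (fun x => ⟨if n = 0 then x.a else 0, if n = 0 then x.r else 0,
    if n = 1 then x.b else 0, if n = 1 then x.s else 0, if n = 2 then x.z else 0⟩)
    fun x y => by ext <;> simp <;> split_ifs <;> simp

theorem gr_apply (n : ℕ) (x : TwistLie σ) : gr σ n x = ⟨if n = 0 then x.a else 0,
    if n = 0 then x.r else 0, if n = 1 then x.b else 0, if n = 1 then x.s else 0,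
    if n = 2 then x.z else 0⟩ := rfl

theorem exists_eq_or_ge_three (n : ℕ) : n = 0 ∨ n = 1 ∨ n = 2 ∨ ∃ m, n = m + 3 := by
  rcases n with _ | _ | _ | n
  exacts [Or.inl rfl, Or.inr (Or.inl rfl), Or.inr (Or.inr (Or.inl rfl)),
    Or.inr (Or.inr (Or.inr ⟨n, rfl⟩))]

/-- The coordinates of degree at most `n` vanish. -/
def LowVanish (n : ℕ) (x : TwistLie σ) : Prop :=
  (1 ≤ n → x.a = 0 ∧ x.r = 0) ∧ (2 ≤ n → x.b = 0 ∧ x.s = 0) ∧ (3 ≤ n → x.z = 0)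

theorem lowVanish_crd_mul {n : ℕ} {g h : SplitExt F σ} (hg : LowVanish n (crd g))
    (hh : LowVanish n (crd h)) :
    LowVanish n (crd (g * h)) ∧ gr σ n (crd (g * h)) = gr σ n (crd g) + gr σ n (crd h) := by
  rw [← map_add, crd_mul]
  unfold LowVanish at *
  simp only [gr_apply]
  obtain rfl | rfl | rfl | ⟨n, rfl⟩ := exists_eq_or_ge_three n <;> simp_all

theorem lowVanish_crd_inv {n : ℕ} {g : SplitExt F σ} (hg : LowVanish n (crd g)) :
    LowVanish n (crd g⁻¹) := by
  have h : crd (g⁻¹ * g) = 0 := by rw [inv_mul_cancel, crd_one]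
  rw [crd_mul, TwistLie.ext_iff] at h
  unfold LowVanish at *
  obtain rfl | rfl | rfl | ⟨n, rfl⟩ := exists_eq_or_ge_three n <;> simp_all

variable (σ) in
/-- The subgroup on which all coordinates of degree at most `n` vanish. -/
def filt (n : ℕ) : Subgroup (SplitExt F σ) where
  carrier := {g | LowVanish n (crd g)}
  one_mem' := by simp [LowVanish, crd_one]
  mul_mem' hg hh := (lowVanish_crd_mul hg hh).1
  inv_mem' := lowVanish_crd_inv

theorem mem_filt {n : ℕ} {g : SplitExt F σ} : g ∈ filt σ n ↔ LowVanish n (crd g) := Iff.rfl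

theorem gr_crd_mul {n : ℕ} {g h : SplitExt F σ} (hg : g ∈ filt σ n) (hh : h ∈ filt σ n) :
    gr σ n (crd (g * h)) = gr σ n (crd g) + gr σ n (crd h) := (lowVanish_crd_mul hg hh).2

theorem mem_filt_succ {n : ℕ} {g : SplitExt F σ} :
    g ∈ filt σ (n + 1) ↔ g ∈ filt σ n ∧ gr σ n (crd g) = 0 := by
  rw [mem_filt, mem_filt, LowVanish, LowVanish, gr_apply, TwistLie.ext_iff]
  obtain rfl | rfl | rfl | ⟨n, rfl⟩ := exists_eq_or_ge_three n <;> simp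
  tauto

theorem filt_add_three (n : ℕ) : filt σ (n + 3) = ⊥ := by
  rw [eq_bot_iff]
  intro g hg
  rw [mem_filt, LowVanish] at hg
  refine crd_injective (TwistLie.ext ?_ ?_ ?_ ?_ ?_)
  exacts [(hg.1 (by omega)).1, (hg.1 (by omega)).2, (hg.2.1 (by omega)).1, (hg.2.1 (by omega)).2,
    hg.2.2 (by omega)]

/-- Up to a correction in degree three, the commutator is the Lie bracket; the correction vanishes
as soon as one of the elements has zero coordinates of degree one. -/
theorem crd_commutator (g h : SplitExt F σ) : crd ⁅g, h⁆ = ⁅crd g, crd h⁆ -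
    ⟨0, 0, 0, 0, ⁅crd g, crd h⁆.b * σ (σ ((crd g).r + (crd h).r))⟩ := by
  have e : crd (⁅g, h⁆ * (h * g)) = crd (g * h) := by
    rw [commutatorElement_def]; congr 1; group
  rw [crd_mul, crd_mul, crd_mul] at e
  generalize crd ⁅g, h⁆ = c at *
  generalize crd g = x at *
  generalize crd h = y at *
  rw [TwistLie.ext_iff] at e
  simp at e
  obtain ⟨ha, hr, hb, hs, hz⟩ := e
  have ha : c.a = 0 := by linear_combination ha
  have hr : c.r = 0 := by linear_combination hr
  rw [ha] at hb hs hz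
  have hb : c.b = ⁅x, y⁆.b := by rw [TwistLie.lie_b]; linear_combination hb
  rw [hb, TwistLie.lie_b] at hz
  ext
  · simpa using ha
  · simpa using hr
  · simpa using hb
  · simp
    linear_combination hs
  · simp
    linear_combination hz

theorem commutator_mem_filt {n : ℕ} {g : SplitExt F σ} (hg : g ∈ filt σ n) (h : SplitExt F σ) :
    ⁅g, h⁆ ∈ filt σ (n + 1) := by
  rw [mem_filt, LowVanish] at hg ⊢
  rw [crd_commutator]
  obtain rfl | rfl | rfl | ⟨n, rfl⟩ := exists_eq_or_ge_three n <;> simp_all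

/-- The bracket of the Lie algebra is induced by the commutator. -/
theorem gr_crd_commutator {n m : ℕ} {g h : SplitExt F σ} (hg : g ∈ filt σ n) (hh : h ∈ filt σ m) :
    gr σ (n + m + 1) (crd ⁅g, h⁆) = ⁅gr σ n (crd g), gr σ m (crd h)⁆ := by
  rw [mem_filt, LowVanish] at hg hh
  rw [gr_apply, gr_apply, gr_apply, crd_commutator]
  generalize crd g = x at *
  generalize crd h = y at *
  obtain rfl | rfl | rfl | ⟨n, rfl⟩ := exists_eq_or_ge_three n <;>
  obtain rfl | rfl | rfl | ⟨m, rfl⟩ := exists_eq_or_ge_three m <;>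
  ext <;> simp_all

end Filtration

/-! ### The `p`-central series in coordinates -/

section Series

variable {F : Type*} [Field F] {σ : F →+* F} {p : ℕ} [Algebra (ZMod p) F]

theorem gr_crd_pow {n : ℕ} {g : SplitExt F σ} (hg : g ∈ filt σ n) (k : ℕ) :
    gr σ n (crd (g ^ k)) = k • gr σ n (crd g) := by
  induction k with
  | zero => rw [pow_zero, crd_one, map_zero, zero_smul]
  | succ k ih => rw [pow_succ, gr_crd_mul (pow_mem hg k) hg, ih, succ_nsmul]

theorem pow_mem_filt {n : ℕ} {g : SplitExt F σ} (hg : g ∈ filt σ n) : g ^ p ∈ filt σ (n + 1) := by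
  rw [mem_filt_succ, gr_crd_pow hg]
  exact ⟨pow_mem hg p, ZModModule.char_nsmul_eq_zero p _⟩

theorem pCentralSeries_le_filt (n : ℕ) : pCentralSeries p (SplitExt F σ) n ≤ filt σ n := by
  induction n with
  | zero => exact fun g _ => by simp [mem_filt, LowVanish]
  | succ n ih =>
    refine sup_le ((Subgroup.commutator_le).2 fun g hg h _ => commutator_mem_filt (ih hg) h) ?_
    rw [Subgroup.closure_le]
    rintro _ ⟨g, hg, rfl⟩
    exact pow_mem_filt (ih hg)

variable [IsCubicTwist σ]

omit [Algebra (ZMod p) F] in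
/-- An element of the last layer is a commutator `[g, h]`, where `h` has `a = 1` and `g` has all
coordinates but `s` equal to zero. -/
theorem filt_two_le {n : ℕ} (hn : n ≤ 1) (hle : filt σ n ≤ pCentralSeries p (SplitExt F σ) n) :
    filt σ 2 ≤ pCentralSeries p (SplitExt F σ) (n + 1) := by
  intro g hg
  obtain ⟨h, hh⟩ := crd_surjective (⟨1, 0, 0, 0, 0⟩ : TwistLie σ)
  obtain ⟨k, hk⟩ := crd_surjective (⟨0, 0, 0, - σ (σ (crd g).z), 0⟩ : TwistLie σ)
  have : g = ⁅k, h⁆ := by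
    simp only [mem_filt, LowVanish] at hg
    refine crd_injective ?_
    rw [crd_commutator, hh, hk]
    ext <;> simp [hg]
  rw [this]
  refine comm_mem_pCentralSeries_succ (hle ?_) h
  obtain rfl | rfl : n = 0 ∨ n = 1 := by omega
  · simp [mem_filt, LowVanish]
  · simp [mem_filt, LowVanish, hk]

variable [Fact p.Prime]

theorem filt_one_le (hF : Module.finrank (ZMod p) F = 3) :
    filt σ 1 ≤ pCentralSeries p (SplitExt F σ) 1 := by
  have h₀ : filt σ 2 ≤ pCentralSeries p (SplitExt F σ) 1 :=
    filt_two_le (n := 0) (by omega) fun _ _ => Subgroup.mem_top _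
  have hfilt : ∀ g : SplitExt F σ, g ∈ pCentralSeries p (SplitExt F σ) 1 →
      (crd g).a = 0 ∧ (crd g).r = 0 := fun g hg => by
    simpa [mem_filt, LowVanish] using pCentralSeries_le_filt 1 hg
  have hcomm : ∀ g h : SplitExt F σ, ⁅g, h⁆ ∈ pCentralSeries p (SplitExt F σ) 1 := fun g h =>
    comm_mem_pCentralSeries_succ (n := 0) (Subgroup.mem_top g) h
  -- The commutators of elements of `U₁(R)` produce every coordinate `b`.
  have hb : ∀ b, ∃ g ∈ pCentralSeries p (SplitExt F σ) 1, (crd g).b = b ∧ (crd g).s = 0 := by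
    let S : AddSubgroup F :=
      { carrier := {b | ∃ g ∈ pCentralSeries p (SplitExt F σ) 1, (crd g).b = b ∧ (crd g).s = 0}
        zero_mem' := ⟨1, one_mem _, rfl, rfl⟩
        add_mem' := by
          rintro _ _ ⟨g, hg, rfl, hgs⟩ ⟨h, hh, rfl, hhs⟩
          exact ⟨g * h, mul_mem hg hh, by rw [crd_mul]; simp [hfilt g hg, hgs, hhs]⟩
        neg_mem' := by
          rintro _ ⟨g, hg, rfl, hgs⟩
          have e : crd (g * g⁻¹) = 0 := by rw [mul_inv_cancel, crd_one]
          rw [crd_mul, TwistLie.ext_iff] at e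
          simp [hfilt g hg, hgs] at e
          exact ⟨g⁻¹, inv_mem hg, by linear_combination e.2.2.1, e.2.2.2.1⟩ }
    have hS : S = ⊤ := addSubgroup_eq_top_of_twist_comm (σ := σ) hF fun x y => by
      obtain ⟨g, hg⟩ := crd_surjective (⟨x, 0, 0, 0, 0⟩ : TwistLie σ)
      obtain ⟨h, hh⟩ := crd_surjective (⟨y, 0, 0, 0, 0⟩ : TwistLie σ)
      exact ⟨⁅g, h⁆, hcomm g h, by rw [crd_commutator, hg, hh]; simp⟩
    intro b
    have hb : b ∈ S := hS ▸ AddSubgroup.mem_top b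
    exact hb
  have hs : ∀ s, ∃ g ∈ pCentralSeries p (SplitExt F σ) 1, (crd g).b = 0 ∧ (crd g).s = s := by
    intro s
    obtain ⟨g, hg⟩ := crd_surjective (⟨1, 0, 0, 0, 0⟩ : TwistLie σ)
    obtain ⟨h, hh⟩ := crd_surjective (⟨0, σ (σ s), 0, 0, 0⟩ : TwistLie σ)
    exact ⟨⁅g, h⁆, hcomm g h, by rw [crd_commutator, hg, hh]; simp⟩
  intro g hg
  obtain ⟨k, hk, hkb, hks⟩ := hb (crd g).b
  obtain ⟨l, hl, hlb, hls⟩ := hs (crd g).s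
  have hkl := mul_mem hk hl
  have : (k * l)⁻¹ * g ∈ filt σ 2 := by
    have hm := pCentralSeries_le_filt 1 hkl
    refine mem_filt_succ.2 ⟨mul_mem (inv_mem hm) hg, ?_⟩
    have e := gr_crd_mul hm (mul_mem (inv_mem hm) hg)
    rw [mul_inv_cancel_left, gr_crd_mul (pCentralSeries_le_filt 1 hk)
      (pCentralSeries_le_filt 1 hl)] at e
    refine left_eq_add.1 (Eq.trans ?_ e)
    simp [gr_apply, TwistLie.ext_iff, hkb, hks, hlb, hls]
  have h := mul_mem hkl (h₀ this)
  rwa [mul_inv_cancel_left] at h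

theorem pCentralSeries_eq_filt (hF : Module.finrank (ZMod p) F = 3) (n : ℕ) :
    pCentralSeries p (SplitExt F σ) n = filt σ n := by
  refine le_antisymm (pCentralSeries_le_filt n) ?_
  obtain rfl | rfl | rfl | ⟨n, rfl⟩ := exists_eq_or_ge_three n
  · exact fun _ _ => Subgroup.mem_top _
  · exact filt_one_le hF
  · exact filt_two_le (n := 1) le_rfl (filt_one_le hF)
  · rw [filt_add_three]
    exact bot_le

end Series

section Layers

variable {F : Type*} [Field F] {σ : F →+* F} {p : ℕ} [Fact p.Prime] [Algebra (ZMod p) F]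

variable (σ p) in
/-- The layer `Gⁿ⁺¹ / Gⁿ⁺²`, as the part of degree `n + 1` of the Lie algebra. -/
def layerHom (n : ℕ) : PLayer p (SplitExt F σ) n →+ TwistLie σ :=
  MonoidHom.toAdditiveLeft (QuotientGroup.lift _
    (MonoidHom.mk' (fun x : pCentralSeries p (SplitExt F σ) n =>
        Multiplicative.ofAdd (gr σ n (crd (x : SplitExt F σ))))
      fun x y => congrArg Multiplicative.ofAdd
        (gr_crd_mul (pCentralSeries_le_filt n x.2) (pCentralSeries_le_filt n y.2)))
    fun _ hx => congrArg Multiplicative.ofAdd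
      (mem_filt_succ.1 (pCentralSeries_le_filt (n + 1) (Subgroup.mem_subgroupOf.1 hx))).2)

theorem layerHom_pcls {n : ℕ} (x : pCentralSeries p (SplitExt F σ) n) :
    layerHom σ p n (pcls x) = gr σ n (crd (x : SplitExt F σ)) := rfl

theorem gr_gr (n m : ℕ) (x : TwistLie σ) : gr σ n (gr σ m x) = if n = m then gr σ m x else 0 := by
  split_ifs with h
  · subst h
    simp only [gr_apply]
    ext <;> simp +contextual
  · simp only [gr_apply]
    ext <;> simp +contextual <;> intros <;> omega

variable (σ p) in
/-- The map from the Lie algebra of the `p`-central series to the coordinates. -/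
noncomputable def layersHom : PCentralLie p (SplitExt F σ) →+ TwistLie σ :=
  DirectSum.toAddMonoid (layerHom σ p)

theorem layersHom_of {n : ℕ} (x : pCentralSeries p (SplitExt F σ) n) :
    layersHom σ p (PCentralLie.of n (pcls x)) = gr σ n (crd (x : SplitExt F σ)) :=
  (DirectSum.toAddMonoid_of _ _ _).trans (layerHom_pcls x)

theorem layersHom_lie (x y : PCentralLie p (SplitExt F σ)) :
    layersHom σ p ⁅x, y⁆ = ⁅layersHom σ p x, layersHom σ p y⁆ := by
  induction x using PCentralLie.induction with
  | hadd x x' h h' => rw [add_lie, map_add, map_add, add_lie, h, h']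
  | h n g =>
    induction y using PCentralLie.induction with
    | hadd y y' h h' => rw [lie_add, map_add, map_add, lie_add, h, h']
    | h m k =>
      have : ⁅PCentralLie.of n (pcls g), PCentralLie.of m (pcls k)⁆ =
        PCentralLie.of (n + m + 1) (pcls (pcomm g k)) := PCentralLie.bracketHom_pcls g k
      rw [this, layersHom_of, layersHom_of, layersHom_of]
      exact gr_crd_commutator (pCentralSeries_le_filt n g.2) (pCentralSeries_le_filt m k.2)

theorem gr_layersHom (n : ℕ) (x : DirectSum ℕ (PLayer p (SplitExt F σ))) :
    gr σ n (DirectSum.toAddMonoid (layerHom σ p) x) = layerHom σ p n (x n) := by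
  induction x using DirectSum.induction_on with
  | zero => rw [map_zero, map_zero, DirectSum.zero_apply, map_zero]
  | add x y hx hy => rw [map_add, map_add, hx, hy, DirectSum.add_apply, map_add]
  | of m x =>
    obtain ⟨g, rfl⟩ := pcls_surjective x
    rw [DirectSum.toAddMonoid_of, layerHom_pcls, gr_gr]
    split_ifs with h
    · subst h
      rw [DirectSum.of_eq_same, layerHom_pcls]
    · rw [DirectSum.of_eq_of_ne _ _ _ h, map_zero]

theorem layersHom_injective (σ : F →+* F) [IsCubicTwist σ] (hF : Module.finrank (ZMod p) F = 3) :
    Function.Injective (layersHom σ p) := by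
  rw [injective_iff_map_eq_zero]
  intro x hx
  have hx' : DirectSum.toAddMonoid (layerHom σ p) x = 0 := hx
  refine DFinsupp.ext (β := PLayer p (SplitExt F σ)) fun n => ?_
  have h := gr_layersHom n x
  rw [hx', map_zero] at h
  generalize (show DirectSum ℕ (PLayer p (SplitExt F σ)) from x) n = y at h
  obtain ⟨g, rfl⟩ := pcls_surjective y
  rw [layerHom_pcls] at h
  refine pcls_eq_zero_iff.2 ?_
  rw [pCentralSeries_eq_filt hF]
  exact mem_filt_succ.2 ⟨pCentralSeries_le_filt n g.2, h.symm⟩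

theorem layersHom_surjective (σ : F →+* F) [IsCubicTwist σ] (hF : Module.finrank (ZMod p) F = 3) :
    Function.Surjective (layersHom σ p) := by
  have layer : ∀ (n : ℕ) (x : TwistLie σ), LowVanish n x →
      ∃ y, layersHom σ p y = gr σ n x := fun n x hx => by
    obtain ⟨g, rfl⟩ := crd_surjective x
    exact ⟨PCentralLie.of n (pcls ⟨g, (pCentralSeries_eq_filt (σ := σ) hF n).symm ▸ hx⟩),
      layersHom_of _⟩
  intro x
  obtain ⟨y₀, h₀⟩ := layer 0 ⟨x.a, x.r, 0, 0, 0⟩ (by simp [LowVanish])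
  obtain ⟨y₁, h₁⟩ := layer 1 ⟨0, 0, x.b, x.s, 0⟩ (by simp [LowVanish])
  obtain ⟨y₂, h₂⟩ := layer 2 ⟨0, 0, 0, 0, x.z⟩ (by simp [LowVanish])
  refine ⟨y₀ + y₁ + y₂, ?_⟩
  rw [map_add, map_add, h₀, h₁, h₂]
  ext <;> simp [gr_apply]

variable (σ p) in
/-- The Lie algebra of the `p`-central series of the split extension, in coordinates. -/
noncomputable def pCentralLieEquiv [IsCubicTwist σ] (hF : Module.finrank (ZMod p) F = 3) :
    PCentralLie p (SplitExt F σ) ≃ₗ⁅ZMod p⁆ TwistLie σ :=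
  { LinearEquiv.ofBijective ((layersHom σ p).toZModLinearMap p)
      ⟨layersHom_injective σ hF, layersHom_surjective σ hF⟩ with
    map_lie' := fun {x y} => layersHom_lie x y }

end Layers

end SplitExt

/-! ### Frobenius twists of the field with `p³` elements -/

section Frobenius

variable {p : ℕ} [Fact p.Prime]

theorem isCubicTwist_iterateFrobenius {e : ℕ} (he : e ∈ ({1, 2} : Set ℕ)) :
    IsCubicTwist (iterateFrobenius (GaloisField p 3) p e) := by
  have hp : p.Prime := Fact.out
  have hcard : Nat.card (GaloisField p 3) = p ^ 3 := GaloisField.card p 3 (by norm_num)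
  have hfix : ∀ x : GaloisField p 3, x ^ p ^ 3 = x := fun x => by
    
    have := Fintype.ofFinite (GaloisField p 3)
    rw [← hcard, Nat.card_eq_fintype_card]
    exact FiniteField.pow_card x
  refine ⟨fun x => ?_, ?_⟩
  · simp only [iterateFrobenius_def, ← pow_mul, ← pow_add]
    rcases he with rfl | rfl
    · exact hfix x
    · rw [show p ^ (2 + 2 + 2) = p ^ 3 * p ^ 3 by ring, pow_mul, hfix, hfix]
  · obtain ⟨g, hg⟩ := IsCyclic.exists_ofOrder_eq_natCard (α := (GaloisField p 3)ˣ)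
    rw [Nat.card_units, hcard] at hg
    refine ⟨g, fun h => ?_⟩
    rw [iterateFrobenius_def] at h
    have h1 : 1 ≤ p ^ e := Nat.one_le_pow _ _ hp.pos
    have h' : g ^ (p ^ e - 1) = 1 := by
      have : g ^ (p ^ e - 1) * g = 1 * g := by
        rw [← pow_succ, Nat.sub_add_cancel h1, one_mul]
        exact Units.ext (by simpa using h)
      exact mul_right_cancel this
    have hlt' : p ^ e < p ^ 3 :=
      Nat.pow_lt_pow_right hp.one_lt (by rcases he with rfl | rfl <;> norm_num)
    have hgt : 1 < p ^ e := Nat.one_lt_pow (by rcases he with rfl | rfl <;> norm_num) hp.one_lt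
    have := Nat.le_of_dvd (by omega) (hg ▸ orderOf_dvd_of_pow_eq_one h')
    omega

end Frobenius

/-! ### Almost-inner derivations for Sah's groups -/

section Sha

variable {p : ℕ} [Fact p.Prime]

/-- A decomposition of the almost-inner derivations is transported along an isomorphism. -/
theorem LieEquiv.exists_compl_innDer {R L L' : Type*} [CommRing R] [LieRing L] [LieAlgebra R L]
    [LieRing L'] [LieAlgebra R L'] (e : L ≃ₗ⁅R⁆ L') {U : LieSubalgebra R (LieDerivation R L L)}
    (hd : Disjoint (InnDer R L).toSubmodule U.toSubmodule)
    (hs : (InnDer R L).toSubmodule ⊔ U.toSubmodule = (AID R L).toSubmodule) :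
    Disjoint (InnDer R L').toSubmodule (U.map e.derivationCongr.toLieHom).toSubmodule ∧
      (InnDer R L').toSubmodule ⊔ (U.map e.derivationCongr.toLieHom).toSubmodule =
        (AID R L').toSubmodule ∧
      Module.finrank R (U.map e.derivationCongr.toLieHom) = Module.finrank R U := by
  have hU : (U.map e.derivationCongr.toLieHom).toSubmodule = U.toSubmodule.map
    (e.derivationCongr.toLinearEquiv : LieDerivation R L L →ₗ[R] _) := rfl
  refine ⟨?_, ?_, ?_⟩
  · rw [hU, ← e.map_innDer]
    exact Submodule.disjoint_map e.derivationCongr.toLinearEquiv.injective hd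
  · rw [hU, ← e.map_innDer, ← e.map_AID, ← Submodule.map_sup, hs]
  · exact LinearEquiv.finrank_map_eq e.derivationCongr.toLinearEquiv U.toSubmodule

theorem not_isLieAbelian_sha_sahGroup {e : ℕ} (he : e ∈ ({1, 2} : Set ℕ)) :
    ¬ IsLieAbelian (Sha (ZMod p) (PCentralLie p (SahGroup p e))) := by
  have := isCubicTwist_iterateFrobenius (p := p) he
  have hF : Module.finrank (ZMod p) (GaloisField p 3) = 3 := GaloisField.finrank p (by norm_num)
  set σ := iterateFrobenius (GaloisField p 3) p e
  let f := (SplitExt.pCentralLieEquiv σ p hF).symm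
  let P : Fin 11 → GaloisField p 3 := Pi.single 1 1
  let Q : Fin 11 → GaloisField p 3 := Pi.single 3 1
  refine not_isLieAbelian_sha (f.derivationCongr_mem_AID.2 (TwistLie.aidDer_mem_AID P))
    (f.derivationCongr_mem_AID.2 (TwistLie.aidDer_mem_AID Q)) ?_
  rw [← LieEquiv.map_lie, f.derivationCongr_mem_innDer]
  refine TwistLie.lie_aidDer_notMem_innDer hF ?_
  simp [P, Q]

theorem exists_compl_innDer_sahGroup {e : ℕ} (he : e ∈ ({1, 2} : Set ℕ)) :
    Module.finrank (ZMod p) (PCentralLie p (SahGroup p e)) = 15 ∧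
    ∃ U : Submodule (ZMod p) (LieDerivation (ZMod p) (PCentralLie p (SahGroup p e))
        (PCentralLie p (SahGroup p e))),
      Disjoint (InnDer (ZMod p) (PCentralLie p (SahGroup p e))).toSubmodule U ∧
      (InnDer (ZMod p) (PCentralLie p (SahGroup p e))).toSubmodule ⊔ U =
        (AID (ZMod p) (PCentralLie p (SahGroup p e))).toSubmodule ∧
      Module.finrank (ZMod p) U = 21 := by
  have := isCubicTwist_iterateFrobenius (p := p) he
  have hF : Module.finrank (ZMod p) (GaloisField p 3) = 3 := GaloisField.finrank p (by norm_num)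
  set σ := iterateFrobenius (GaloisField p 3) p e
  let f := SplitExt.pCentralLieEquiv σ p hF
  obtain ⟨hd, hs, hr⟩ := f.symm.exists_compl_innDer (TwistLie.disjoint_innDer_compl (σ := σ) hF)
    (TwistLie.innDer_sup_compl hF)
  exact ⟨f.toLinearEquiv.finrank_eq.trans (TwistLie.finrank_eq hF), _, hd, hs,
    hr.trans (TwistLie.finrank_compl hF)⟩

end Sha

/-! ### Coordinates on the field with `27` elements -/

section CubicCoordinates

/-- The product of `𝔽₃[X] / (X³ - X - 1)` in the basis `1, α, α²`. -/
def cubicMul (x y : Fin 3 → ZMod 3) : Fin 3 → ZMod 3 :=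
  ![x 0 * y 0 + (x 1 * y 2 + x 2 * y 1),
    x 0 * y 1 + x 1 * y 0 + (x 1 * y 2 + x 2 * y 1) + x 2 * y 2,
    x 0 * y 2 + x 1 * y 1 + x 2 * y 0 + x 2 * y 2]

/-- The automorphism `α ↦ α - 1` of `𝔽₃[X] / (X³ - X - 1)` in the basis `1, α, α²`. -/
def cubicTwist (x : Fin 3 → ZMod 3) : Fin 3 → ZMod 3 := ![x 0 - x 1 + x 2, x 1 + x 2, x 2]

variable {F : Type*} [Field F] [Algebra (ZMod 3) F] {σ : F →+* F} {α : F}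

variable (α) in
/-- The map with the coordinates `x` with respect to `1, α, α²`. -/
def cubicEmb : (Fin 3 → ZMod 3) →ₗ[ZMod 3] F :=
  AddMonoidHom.toZModLinearMap 3 (AddMonoidHom.mk'
    (fun x => algebraMap (ZMod 3) F (x 0) + algebraMap (ZMod 3) F (x 1) * α +
      algebraMap (ZMod 3) F (x 2) * α ^ 2) fun x y => by simp only [Pi.add_apply, map_add]; ring)

theorem cubicEmb_apply (x : Fin 3 → ZMod 3) : cubicEmb α x = algebraMap (ZMod 3) F (x 0) +
    algebraMap (ZMod 3) F (x 1) * α + algebraMap (ZMod 3) F (x 2) * α ^ 2 := rfl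

theorem cubicEmb_mul (hα : α ^ 3 = α + 1) (x y : Fin 3 → ZMod 3) :
    cubicEmb α (cubicMul x y) = cubicEmb α x * cubicEmb α y := by
  simp only [cubicEmb_apply, cubicMul, Matrix.cons_val, map_add, map_mul]
  linear_combination -(algebraMap (ZMod 3) F (x 1) * algebraMap (ZMod 3) F (y 2) +
    algebraMap (ZMod 3) F (x 2) * algebraMap (ZMod 3) F (y 1) +
    algebraMap (ZMod 3) F (x 2) * algebraMap (ZMod 3) F (y 2) * α) * hα

theorem cubicEmb_twist (hσα : σ α = α - 1) (x : Fin 3 → ZMod 3) :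
    cubicEmb α (cubicTwist x) = σ (cubicEmb α x) := by
  have h3 : (3 : F) = 0 := by
    have : algebraMap (ZMod 3) F 3 = 0 := (congrArg _ (by decide)).trans (map_zero _)
    rwa [map_ofNat] at this
  have hfix : ∀ c : ZMod 3, σ (algebraMap (ZMod 3) F c) = algebraMap (ZMod 3) F c := fun c =>
    RingHom.congr_fun (Subsingleton.elim (σ.comp (algebraMap (ZMod 3) F)) _) c
  simp only [cubicEmb_apply, cubicTwist, Matrix.cons_val, map_add, map_sub, map_mul, map_pow, hσα,
    hfix]
  linear_combination (algebraMap (ZMod 3) F (x 2) * α) * h3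

theorem cubicEmb_injective (hσα : σ α = α - 1) :
    Function.Injective (cubicEmb α) := by
  rw [injective_iff_map_eq_zero]
  intro x hx
  have hsub : ∀ y : Fin 3 → ZMod 3, cubicTwist y - y = ![y 2 - y 1, y 2, 0] := fun y => by
    funext i
    fin_cases i <;> simp [cubicTwist]; ring
  have twist : ∀ y, cubicEmb α y = 0 → cubicEmb α ![y 2 - y 1, y 2, 0] = 0 := fun y hy => by
    rw [← hsub, map_sub, cubicEmb_twist hσα, hy, map_zero, sub_zero]
  have h₁ := twist x hx
  have h₂ := twist _ h₁
  -- `σ - 1` lowers the degree in `α`, so the coefficients vanish one after another from the top.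
  have h2 : x 2 = 0 := by
    simpa [cubicEmb_apply] using h₂
  have h1 : x 1 = 0 := by
    simpa [cubicEmb_apply, h2] using h₁
  have h0 : x 0 = 0 := by
    simpa [cubicEmb_apply, h1, h2] using hx
  funext i
  fin_cases i <;> assumption

/-- For `p = 3` the element `1` has trace zero, so it is of the form `α - σ(α)`; the twist acts on
such an `α` by translation, which makes it a root of `X³ - X - 1`. -/
theorem exists_artinSchreier_root (σ : GaloisField 3 3 →+* GaloisField 3 3)
    (hσ : σ = iterateFrobenius (GaloisField 3 3) 3 2) :
    ∃ α : GaloisField 3 3, σ α = α - 1 ∧ α ^ 3 = α + 1 := by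
  have : IsCubicTwist σ := hσ ▸ isCubicTwist_iterateFrobenius (by simp)
  have h3 : (3 : GaloisField 3 3) = 0 := by exact_mod_cast CharP.cast_eq_zero (GaloisField 3 3) 3
  obtain ⟨α, hα⟩ := exists_sub_twist_eq (σ := σ) (x := 1) (by
    simp only [twistTrace, map_one]
    linear_combination h3)
  have hσα : σ α = α - 1 := by linear_combination -hα
  refine ⟨α, hσα, ?_⟩
  have h27 : ∀ x : GaloisField 3 3, x ^ 27 = x := fun x => by
    have := Fintype.ofFinite (GaloisField 3 3)
    have hcard : Nat.card (GaloisField 3 3) = 3 ^ 3 := GaloisField.card 3 3 (by norm_num)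
    have h := FiniteField.pow_card x
    rwa [← Nat.card_eq_fintype_card, hcard] at h
  have h₁ : σ (σ α) = α ^ 3 := by
    rw [hσ, iterateFrobenius_def, iterateFrobenius_def]
    calc ((α ^ 3 ^ 2) ^ 3 ^ 2) = (α ^ 27) ^ 3 := by ring
      _ = α ^ 3 := by rw [h27]
  have h₂ : σ (σ α) = α - 1 - 1 := by rw [hσα, map_sub, hσα, map_one]
  linear_combination h₂ - h₁ - h3

end CubicCoordinates

/-! ### The isomorphism with `𝔤₃` -/

namespace G3

/-- The coordinates of `a` with respect to `1, α, α²`. -/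
def kA (x : G3) : Fin 3 → ZMod 3 := ![x 0, 2 * x 1, x 2]
/-- The coordinates of `r` with respect to `1, α, α²`. -/
def kR (x : G3) : Fin 3 → ZMod 3 := ![x 3 + 2 * x 4 + x 5, x 4 + x 5, 2 * x 4]
/-- The coordinates of `b` with respect to `1, α, α²`. -/
def kB (x : G3) : Fin 3 → ZMod 3 := ![2 * x 6 + x 7 + x 8, 2 * x 7 + x 8, x 8]
/-- The coordinates of `s` with respect to `1, α, α²`. -/
def kS (x : G3) : Fin 3 → ZMod 3 := ![2 * x 9, x 11, 2 * x 10]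
/-- The coordinates of `z` with respect to `1, α, α²`. -/
def kZ (x : G3) : Fin 3 → ZMod 3 := ![x 12 + x 13 + x 14, 2 * x 14, 2 * x 13]

theorem kAR_basisBracket : ∀ i j : Fin 15,
    kA (basisBracket i j) = 0 ∧ kR (basisBracket i j) = 0 := by
  decide +kernel

theorem kB_basisBracket : ∀ i j : Fin 15, kB (basisBracket i j) =
    cubicMul (kA (v (i + 1))) (cubicTwist (kA (v (j + 1)))) -
      cubicMul (kA (v (j + 1))) (cubicTwist (kA (v (i + 1)))) := by
  decide +kernel

theorem kS_basisBracket : ∀ i j : Fin 15, kS (basisBracket i j) =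
    cubicMul (kA (v (i + 1))) (cubicTwist (kR (v (j + 1)))) -
      cubicMul (kA (v (j + 1))) (cubicTwist (kR (v (i + 1)))) := by
  decide +kernel

theorem kZ_basisBracket : ∀ i j : Fin 15, kZ (basisBracket i j) =
    cubicMul (kA (v (i + 1))) (cubicTwist (kS (v (j + 1)))) -
      cubicMul (kA (v (j + 1))) (cubicTwist (kS (v (i + 1)))) +
      cubicMul (kB (v (i + 1))) (cubicTwist (cubicTwist (kR (v (j + 1))))) -
      cubicMul (kB (v (j + 1))) (cubicTwist (cubicTwist (kR (v (i + 1))))) := by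
  decide +kernel

/-- The map `d` satisfies on `x`, in coordinates, the formula for the almost-inner derivation with
the parameters `f, t, q₀, q₁, q₂` and with the other parameters equal to zero. -/
def IsAidDerOn (d : G3 → G3) (f t q₀ q₁ q₂ : Fin 3 → ZMod 3) (x : G3) : Prop :=
  kA (d x) = 0 ∧ kR (d x) = 0 ∧
  kB (d x) = cubicMul f (cubicTwist (kA x)) - cubicMul (kA x) (cubicTwist f) ∧
  kS (d x) = cubicMul q₀ (kA x) + cubicMul q₁ (cubicTwist (kA x)) +
    cubicMul q₂ (cubicTwist (cubicTwist (kA x))) + cubicMul t (kR x) +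
    cubicMul f (cubicTwist (kR x)) ∧
  kZ (d x) = cubicMul (cubicTwist q₀) (kB x) -
    cubicMul (cubicTwist q₁) (cubicTwist (cubicTwist (kB x))) + cubicMul (cubicTwist t) (kS x) +
    cubicMul f (cubicTwist (kS x))

instance (d : G3 → G3) (f t q₀ q₁ q₂ : Fin 3 → ZMod 3) (x : G3) :
    Decidable (IsAidDerOn d f t q₀ q₁ q₂ x) := inferInstanceAs (Decidable (_ ∧ _))

theorem isAidDerOn_d₁ : ∀ i : Fin 15,
    IsAidDerOn d₁ ![2, 0, 0] ![1, 2, 1] 0 0 0 (v (i + 1)) := by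
  decide +kernel

theorem isAidDerOn_d₂ : ∀ i : Fin 15,
    IsAidDerOn d₂ 0 0 ![0, 2, 0] ![1, 2, 0] ![2, 2, 0] (v (i + 1)) := by
  decide +kernel

section Iso

variable {F : Type*} [Field F] [Algebra (ZMod 3) F] {σ : F →+* F} {α : F}

variable (σ α) in
/-- The map from `𝔤₃` to the graded Lie algebra of the twist. -/
def toTwistLie : G3 →ₗ[ZMod 3] TwistLie σ :=
  AddMonoidHom.toZModLinearMap 3 (AddMonoidHom.mk'
    (fun x => ⟨cubicEmb α (kA x), cubicEmb α (kR x), cubicEmb α (kB x), cubicEmb α (kS x),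
      cubicEmb α (kZ x)⟩) fun x y => by
        have hadd : ∀ i, (x + y) i = x i + y i := fun _ => rfl
        ext <;> simp only [TwistLie.add_a, TwistLie.add_r, TwistLie.add_b, TwistLie.add_s,
          TwistLie.add_z, ← map_add] <;> congr 1 <;> funext i <;> fin_cases i <;>
          simp [kA, kR, kB, kS, kZ, hadd] <;> ring)

theorem toTwistLie_apply (x : G3) : toTwistLie σ α x = ⟨cubicEmb α (kA x), cubicEmb α (kR x),
    cubicEmb α (kB x), cubicEmb α (kS x), cubicEmb α (kZ x)⟩ := rfl

theorem toTwistLie_basisBracket (hα : α ^ 3 = α + 1) (hσα : σ α = α - 1) (i j : Fin 15) :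
    toTwistLie σ α (basisBracket i j) =
      ⁅toTwistLie σ α (v (i + 1)), toTwistLie σ α (v (j + 1))⁆ := by
  rw [toTwistLie_apply, (kAR_basisBracket i j).1, (kAR_basisBracket i j).2, kB_basisBracket,
    kS_basisBracket, kZ_basisBracket, toTwistLie_apply, toTwistLie_apply]
  ext <;> simp [cubicEmb_mul hα, cubicEmb_twist hσα]

theorem toTwistLie_bracketLin (hα : α ^ 3 = α + 1) (hσα : σ α = α - 1) (x y : G3) :
    toTwistLie σ α (bracketLin x y) = ⁅toTwistLie σ α x, toTwistLie σ α y⁆ := by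
  have ext_right : ∀ x : G3, (∀ j : Fin 15, toTwistLie σ α (bracketLin x (v (j + 1))) =
      ⁅toTwistLie σ α x, toTwistLie σ α (v (j + 1))⁆) →
      ∀ y, toTwistLie σ α (bracketLin x y) = ⁅toTwistLie σ α x, toTwistLie σ α y⁆ := by
    intro x h y
    have key : toTwistLie σ α ∘ₗ bracketLin x =
        (LieAlgebra.ad (ZMod 3) (TwistLie σ) (toTwistLie σ α x)) ∘ₗ toTwistLie σ α :=
      hom_ext fun j => by rw [LinearMap.comp_apply, LinearMap.comp_apply, h, LieAlgebra.ad_apply]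
    have := LinearMap.congr_fun key y
    rwa [LinearMap.comp_apply, LinearMap.comp_apply, LieAlgebra.ad_apply] at this
  have h₁ : ∀ i : Fin 15, ∀ y, toTwistLie σ α (bracketLin (v (i + 1)) y) =
      ⁅toTwistLie σ α (v (i + 1)), toTwistLie σ α y⁆ := fun i => ext_right _ fun j => by
    rw [bracketLin_v_v, toTwistLie_basisBracket hα hσα]
  refine ext_right x (fun j => ?_) y
  rw [bracketLin_skew, map_neg, h₁, lie_skew]

theorem toTwistLie_injective (hσα : σ α = α - 1) : Function.Injective (toTwistLie σ α) := by
  rw [injective_iff_map_eq_zero]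
  intro x hx
  rw [toTwistLie_apply, TwistLie.ext_iff] at hx
  have inj : ∀ k, cubicEmb α k = 0 → k = 0 := (injective_iff_map_eq_zero _).1
    (cubicEmb_injective hσα)
  obtain ⟨ha, hr, hb, hs, hz⟩ := hx
  replace ha := inj _ ha
  replace hr := inj _ hr
  replace hb := inj _ hb
  replace hs := inj _ hs
  replace hz := inj _ hz
  have h2 : ∀ c : ZMod 3, 2 * c = 0 → c = 0 := by decide
  have a0 : x 0 = 0 := congrFun ha 0
  have a1 : x 1 = 0 := h2 _ (congrFun ha 1)
  have a2 : x 2 = 0 := congrFun ha 2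
  have r4 : x 4 = 0 := h2 _ (congrFun hr 2)
  have r5 : x 5 = 0 := by simpa [kR, r4] using congrFun hr 1
  have r3 : x 3 = 0 := by simpa [kR, r4, r5] using congrFun hr 0
  have b8 : x 8 = 0 := congrFun hb 2
  have b7 : x 7 = 0 := h2 _ (by simpa [kB, b8] using congrFun hb 1)
  have b6 : x 6 = 0 := h2 _ (by simpa [kB, b7, b8] using congrFun hb 0)
  have s9 : x 9 = 0 := h2 _ (congrFun hs 0)
  have s11 : x 11 = 0 := congrFun hs 1
  have s10 : x 10 = 0 := h2 _ (congrFun hs 2)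
  have z14 : x 14 = 0 := h2 _ (congrFun hz 1)
  have z13 : x 13 = 0 := h2 _ (congrFun hz 2)
  have z12 : x 12 = 0 := by simpa [kZ, z13, z14] using congrFun hz 0
  funext i
  fin_cases i <;> assumption

theorem finrank_eq : Module.finrank (ZMod 3) G3 = 15 :=
  (Module.finrank_fintype_fun_eq_card (ZMod 3)).trans (Fintype.card_fin 15)

variable (σ) in
/-- The isomorphism of `𝔤₃` with the graded Lie algebra of the twist. -/
noncomputable def equivTwistLie (hF : Module.finrank (ZMod 3) F = 3) (hα : α ^ 3 = α + 1)
    (hσα : σ α = α - 1) : G3 ≃ₗ⁅ZMod 3⁆ TwistLie σ :=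
  have : Module.Finite (ZMod 3) F := Module.finite_of_finrank_pos (by omega)
  have : Module.Finite (ZMod 3) (TwistLie σ) := Module.Finite.equiv (TwistLie.coords σ 3).symm
  have : Module.Finite (ZMod 3) G3 := inferInstanceAs (Module.Finite (ZMod 3) (Fin 15 → ZMod 3))
  { LinearEquiv.ofBijective (toTwistLie σ α) ⟨toTwistLie_injective hσα,
      (LinearMap.injective_iff_surjective_of_finrank_eq_finrank
        (finrank_eq.trans (TwistLie.finrank_eq hF).symm)).1 (toTwistLie_injective hσα)⟩ with
    map_lie' := fun {x y} => toTwistLie_bracketLin hα hσα x y }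

theorem exists_equiv_symm_eq_toTwistLie (hF : Module.finrank (ZMod 3) F = 3) (hα : α ^ 3 = α + 1)
    (hσα : σ α = α - 1) :
    ∃ g : TwistLie σ ≃ₗ⁅ZMod 3⁆ G3, ∀ x, g.symm x = toTwistLie σ α x :=
  ⟨(equivTwistLie σ hF hα hσα).symm, fun _ => rfl⟩

variable [IsCubicTwist σ]

/-- A linear map that satisfies the formula for an almost-inner derivation on the basis
corresponds to that derivation. -/
theorem toTwistLie_apply_eq_aidDer (hα : α ^ 3 = α + 1) (hσα : σ α = α - 1)
    {d : G3 →ₗ[ZMod 3] G3} {f t q₀ q₁ q₂ : Fin 3 → ZMod 3}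
    (h : ∀ i : Fin 15, IsAidDerOn d f t q₀ q₁ q₂ (v (i + 1))) (x : G3) :
    toTwistLie σ α (d x) = TwistLie.aidDer σ 3 ![cubicEmb α f, cubicEmb α t, cubicEmb α q₀,
      cubicEmb α q₁, cubicEmb α q₂, 0, 0, 0, 0, 0, 0] (toTwistLie σ α x) := by
  refine LinearMap.congr_fun (hom_ext (f := toTwistLie σ α ∘ₗ d)
    (g := (TwistLie.aidDer σ 3 _ : TwistLie σ →ₗ[ZMod 3] TwistLie σ) ∘ₗ toTwistLie σ α)
    fun i => ?_) x
  obtain ⟨ha, hr, hb, hs, hz⟩ := h i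
  change toTwistLie σ α (d (v (i + 1))) = TwistLie.aidDer σ 3 _ (toTwistLie σ α (v (i + 1)))
  rw [TwistLie.aidDer_apply, toTwistLie_apply, toTwistLie_apply, ha, hr, hb, hs, hz]
  ext <;> simp [cubicEmb_mul hα, cubicEmb_twist hσα]

end Iso

section Complement

variable {F : Type*} [Field F] [Algebra (ZMod 3) F] {σ : F →+* F} {α : F} [IsCubicTwist σ]

/-- The derivations `d₁` and `d₂` belong to the complement of the inner derivations; for `d₁` this
is the identity `Tr(1 - α + α²) = -1`. -/
theorem d₁_mem_compl (hF : Module.finrank (ZMod 3) F = 3) (hσα : σ α = α - 1) :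
    TwistLie.aidDer σ 3 ![cubicEmb α ![2, 0, 0], cubicEmb α ![1, 2, 1], cubicEmb α 0, cubicEmb α 0,
      cubicEmb α 0, 0, 0, 0, 0, 0, 0] ∈ TwistLie.compl (σ := σ) hF := by
  refine ⟨![cubicEmb α ![1, 2, 1], 0, 0, 0, 0, 0, 0], ?_⟩
  have ht : twistTrace σ (cubicEmb α ![1, 2, 1]) = cubicEmb α ![2, 0, 0] := by
    rw [twistTrace, ← cubicEmb_twist hσα, ← cubicEmb_twist hσα, ← map_add, ← map_add]
    exact congrArg _ (by decide)
  rw [LinearMap.comp_apply]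
  congr 1
  rw [TwistLie.complParam_apply, map_zero, ← ht]
  funext i
  fin_cases i <;> simp

theorem d₂_mem_compl (hF : Module.finrank (ZMod 3) F = 3) :
    TwistLie.aidDer σ 3 ![cubicEmb α 0, cubicEmb α 0, cubicEmb α ![0, 2, 0],
      cubicEmb α ![1, 2, 0], cubicEmb α ![2, 2, 0], 0, 0, 0, 0, 0, 0] ∈
      TwistLie.compl (σ := σ) hF := by
  refine ⟨![0, cubicEmb α ![1, 2, 0], cubicEmb α ![2, 2, 0], 0, 0, 0, 0], ?_⟩
  have hq : - cubicEmb α ![1, 2, 0] - cubicEmb α ![2, 2, 0] = cubicEmb α ![0, 2, 0] := by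
    rw [← map_neg, ← map_sub]
    exact congrArg _ (by decide)
  rw [LinearMap.comp_apply]
  congr 1
  rw [TwistLie.complParam_apply, map_zero, ← hq]
  funext i
  fin_cases i <;> simp [twistTrace]

theorem finrank_derivations (hF : Module.finrank (ZMod 3) F = 3) (hα : α ^ 3 = α + 1)
    (hσα : σ α = α - 1) : Module.finrank (ZMod 3) (LieDerivation (ZMod 3) G3 G3) = 45 := by
  have h2 : (2 : F) ≠ 0 := by
    have := (algebraMap (ZMod 3) F).injective.ne (show (2 : ZMod 3) ≠ 0 by decide)
    rwa [map_ofNat, map_zero] at this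
  exact (equivTwistLie σ hF hα hσα).derivationCongr.toLinearEquiv.finrank_eq.trans
    (TwistLie.finrank_derivations hF h2)

theorem finrank_innDer (hF : Module.finrank (ZMod 3) F = 3) (hα : α ^ 3 = α + 1)
    (hσα : σ α = α - 1) : Module.finrank (ZMod 3) (InnDer (ZMod 3) G3) = 12 := by
  obtain ⟨g, -⟩ := exists_equiv_symm_eq_toTwistLie hF hα hσα
  change Module.finrank (ZMod 3) (InnDer (ZMod 3) G3).toSubmodule = 12
  rw [← g.map_innDer]
  exact (LinearEquiv.finrank_map_eq g.derivationCongr.toLinearEquiv _).trans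
    (TwistLie.finrank_innDer hF)

theorem exists_compl_innDer (hF : Module.finrank (ZMod 3) F = 3) (hα : α ^ 3 = α + 1)
    (hσα : σ α = α - 1) :
    ∃ U : LieSubalgebra (ZMod 3) (LieDerivation (ZMod 3) G3 G3),
      Disjoint (InnDer (ZMod 3) G3).toSubmodule U.toSubmodule ∧
      (InnDer (ZMod 3) G3).toSubmodule ⊔ U.toSubmodule = (AID (ZMod 3) G3).toSubmodule ∧
      Module.finrank (ZMod 3) U = 21 ∧
      ∃ δ₁ ∈ U, ∃ δ₂ ∈ U, (δ₁ : G3 →ₗ[ZMod 3] G3) = G3.d₁ ∧ (δ₂ : G3 →ₗ[ZMod 3] G3) = G3.d₂ ∧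
        ⁅δ₁, δ₂⁆ ∉ InnDer (ZMod 3) G3 := by
  obtain ⟨g, hg⟩ := exists_equiv_symm_eq_toTwistLie hF hα hσα
  have conj : ∀ {D : LieDerivation (ZMod 3) (TwistLie σ) (TwistLie σ)} {d : G3 →ₗ[ZMod 3] G3},
      (∀ x, toTwistLie σ α (d x) = D (toTwistLie σ α x)) →
      (g.derivationCongr D : G3 →ₗ[ZMod 3] G3) = d := fun {D d} h => LinearMap.ext fun x => by
    change g (D (g.symm x)) = d x
    rw [hg, ← h, ← hg, g.apply_symm_apply]
  have hnot := TwistLie.lie_aidDer_notMem_innDer (σ := σ) hF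
    (P := ![cubicEmb α ![2, 0, 0], cubicEmb α ![1, 2, 1], cubicEmb α 0, cubicEmb α 0,
      cubicEmb α 0, 0, 0, 0, 0, 0, 0])
    (Q := ![cubicEmb α 0, cubicEmb α 0, cubicEmb α ![0, 2, 0],
      cubicEmb α ![1, 2, 0], cubicEmb α ![2, 2, 0], 0, 0, 0, 0, 0, 0]) (by
      have inj := (injective_iff_map_eq_zero _).1 (cubicEmb_injective (F := F) hσα)
      have h₁ : cubicEmb α ![1, 2, 1] ≠ 0 := fun h => absurd (inj _ h) (by decide)
      have h₂ : cubicEmb α ![1, 2, 0] ≠ 0 := fun h => absurd (inj _ h) (by decide)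
      simpa using ⟨h₁, h₂⟩)
  rw [← g.derivationCongr_mem_innDer, LieEquiv.map_lie] at hnot
  obtain ⟨hd, hs, hr⟩ := g.exists_compl_innDer (TwistLie.disjoint_innDer_compl (σ := σ) hF)
    (TwistLie.innDer_sup_compl hF)
  exact ⟨_, hd, hs, hr.trans (TwistLie.finrank_compl hF), _, ⟨_, d₁_mem_compl hF hσα, rfl⟩, _,
    ⟨_, d₂_mem_compl (α := α) hF, rfl⟩, conj (toTwistLie_apply_eq_aidDer hα hσα isAidDerOn_d₁),
    conj (toTwistLie_apply_eq_aidDer hα hσα isAidDerOn_d₂), hnot⟩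

end Complement

end G3

theorem mainTheorem1 :
    -- `𝔤₃` is the Lie algebra of the `p`-central series of Sah's group for `p = 3`
    Nonempty (PCentralLie 3 (SahGroup 3 2) ≃ₗ⁅ZMod 3⁆ G3) ∧
    Module.finrank (ZMod 3) G3 = 15 ∧
    Module.finrank (ZMod 3) (LieDerivation (ZMod 3) G3 G3) = 45 ∧
    Module.finrank (ZMod 3) (InnDer (ZMod 3) G3) = 12 ∧
    -- `AID(𝔤₃) = Inn(𝔤₃) ⊕ U` for a subalgebra `U ∋ d₁, d₂` of dimension `21`
    (∃ U : LieSubalgebra (ZMod 3) (LieDerivation (ZMod 3) G3 G3),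
      Disjoint (InnDer (ZMod 3) G3).toSubmodule U.toSubmodule ∧
      (InnDer (ZMod 3) G3).toSubmodule ⊔ U.toSubmodule = (AID (ZMod 3) G3).toSubmodule ∧
      Module.finrank (ZMod 3) U = 21 ∧
      ∃ δ₁ ∈ U, ∃ δ₂ ∈ U, (δ₁ : G3 →ₗ[ZMod 3] G3) = G3.d₁ ∧ (δ₂ : G3 →ₗ[ZMod 3] G3) = G3.d₂ ∧
        ⁅δ₁, δ₂⁆ ∉ InnDer (ZMod 3) G3) ∧
    ¬ IsLieAbelian (Sha (ZMod 3) G3) ∧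
    -- the case `p = 2`, for both non-trivial twists
    (∀ e ∈ ({1, 2} : Set ℕ),
      Module.finrank (ZMod 2) (PCentralLie 2 (SahGroup 2 e)) = 15 ∧
      (∃ U : Submodule (ZMod 2) (LieDerivation (ZMod 2) (PCentralLie 2 (SahGroup 2 e))
          (PCentralLie 2 (SahGroup 2 e))),
        Disjoint (InnDer (ZMod 2) (PCentralLie 2 (SahGroup 2 e))).toSubmodule U ∧
        (InnDer (ZMod 2) (PCentralLie 2 (SahGroup 2 e))).toSubmodule ⊔ U =
          (AID (ZMod 2) (PCentralLie 2 (SahGroup 2 e))).toSubmodule ∧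
        Module.finrank (ZMod 2) U = 21) ∧
      ¬ IsLieAbelian (Sha (ZMod 2) (PCentralLie 2 (SahGroup 2 e)))) := by
  have hF : Module.finrank (ZMod 3) (GaloisField 3 3) = 3 := GaloisField.finrank 3 (by norm_num)
  have := isCubicTwist_iterateFrobenius (p := 3) (e := 2) (by simp)
  obtain ⟨α, hσα, hα⟩ := exists_artinSchreier_root _ rfl
  obtain ⟨U, hd, hs, hr, δ₁, h₁, δ₂, h₂, hδ₁, hδ₂, hnot⟩ := G3.exists_compl_innDer hF hα hσα
  have hAID : ∀ δ ∈ U, δ ∈ AID (ZMod 3) G3 := fun δ hδ => by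
    rw [← LieSubalgebra.mem_toSubmodule, ← hs]
    exact Submodule.mem_sup_right hδ
  exact ⟨⟨(SplitExt.pCentralLieEquiv _ 3 hF).trans (G3.equivTwistLie _ hF hα hσα).symm⟩,
    G3.finrank_eq, G3.finrank_derivations hF hα hσα, G3.finrank_innDer hF hα hσα,
    ⟨U, hd, hs, hr, δ₁, h₁, δ₂, h₂, hδ₁, hδ₂, hnot⟩,
    not_isLieAbelian_sha (hAID _ h₁) (hAID _ h₂) hnot, fun e he =>
    ⟨(exists_compl_innDer_sahGroup he).1, (exists_compl_innDer_sahGroup he).2,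
      not_isLieAbelian_sha_sahGroup he⟩⟩
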